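/- Let $\gamma>1$ and $M_\gamma=\{(\zeta_1,\zeta_2)\in\mathbb C^2:\operatorname{Im}\zeta_2=|\zeta_1|^\gamma\}$, parametrized by $\zeta=(\alpha e^{i\theta},\,s+i\alpha^\gamma)$ with $s\in\mathbb R$, $\alpha>0$, $0\le\theta<2\pi$ (up to the set $\zeta_1=0$). For $r\in\mathbb R$ let $\mu_r=\alpha^r\,ds\,d\alpha\,d\theta$, and for an integer $k\ge0$ let $L^2_k(M_\gamma,\mu_r)\subset L^2(M_\gamma,\mu_r)$ be the closed subspace of functions of the form $f_k(s,\alpha)e^{ik\theta}$. The Leray transform of $M_\gamma$ is $$\mathbf Lf(z)=\int_{M_\gamma}f(\zeta)\,\frac{4}{\big[\gamma\bar\zeta_1|\zeta_1|^{\gamma-2}(\zeta_1-z_1)+i(\zeta_2-z_2)\big]^2}\;\frac{\gamma^2}{16\pi^2}\,\alpha^{\gamma-1}\,ds\,d\alpha\,d\theta ,\qquad z\in M_\gamma ,$$ where, the kernel being singular at $\zeta=z$, the integral is taken first in $\theta$ and then in $(s,\alpha)$; we say that it converges at $z$ if the resulting integral in $(s,\alpha)$ converges absolutely. The sub-Leray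 operator $\mathbf L_k$ is the restriction of $\mathbf L$ to $L^2_k(M_\gamma,\mu_r)$, and it is called bounded if there is a bounded linear operator on $L^2_k(M_\gamma,\mu_r)$ which agrees ($\mu_r$-almost everywhere) with $\mathbf Lf$ for every $f\in L^2_k(M_\gamma,\mu_r)$ whose integral $\mathbf Lf(z)$ converges for $\mu_r$-almost every $z$. Theorem. Let $\gamma>1$, let $k\ge0$ be an integer and let $r\in\mathbb R$. Then $\mathbf L_k$ is bounded on $L^2_k(M_\gamma,\mu_r)$ if and only if $$r\in\mathcal I_k:=\big(-2k-1,\ (2k+2)(\gamma-1)+1\big).$$ Moreover, when $r\in\mathcal I_k$, the integral $\mathbf Lf(z)$ converges for $\mu_r$-almost every $z$ for every $f\in L^2_k(M_\gamma,\mu_r)$, and $$\|\mathbf L_k\|_{L^2_k(M_\gamma,\mu_r)\to L^2_k(M_\gamma,\mu_r)}=\sqrt{C_{\mu_r}(\gamma,k)},$$ $$C_{\mu_r}(\gamma,k)=\frac{\Gamma\big(\frac{2k+1+r}{\gamma}\big)\,\Gamma\big(2k+2-\frac{2k+1+r}{\gamma}\big)}{\Gamma(k+1)^2}\Big(\frac{\gamma}{2}\Big)^{2k+2}(\gamma-1)^{-\left(2k+2-\frac{2k+1+r}{\gamma}\right)}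 .$$ -/

import Mathlib

open MeasureTheory Set

noncomputable section

namespace Leray

/-- The hypersurface `M_γ = {(ζ₁, ζ₂) ∈ ℂ² : Im ζ₂ = |ζ₁|^γ}`. -/
def hypersurface (γ : ℝ) : Set (ℂ × ℂ) :=
  {ζ | ζ.2.im = ‖ζ.1‖ ^ γ}

/-- The parametrization `(s, α, θ) ↦ (α e^{iθ}, s + i α^γ)` of `M_γ`. -/
def param (γ : ℝ) (p : ℝ × ℝ × ℝ) : ℂ × ℂ :=
  ((p.2.1 : ℂ) * Complex.exp ((p.2.2 : ℂ) * Complex.I),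
    (p.1 : ℂ) + ((p.2.1 ^ γ : ℝ) : ℂ) * Complex.I)

/-- The measure `α^r ds dα dθ` on the parameter domain `s ∈ ℝ`, `α > 0`, `0 ≤ θ < 2π`. -/
def paramMeasure (r : ℝ) : Measure (ℝ × ℝ × ℝ) :=
  (volume.restrict (univ ×ˢ (Ioi 0 ×ˢ Ico 0 (2 * Real.pi)))).withDensity
    fun p => ENNReal.ofReal (p.2.1 ^ r)

/-- The measure `μ_r = α^r ds dα dθ` on `M_γ`, as a measure on `ℂ²` carried by `M_γ`. -/
def mu (γ r : ℝ) : Measure (ℂ × ℂ) :=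
  (paramMeasure r).map (param γ)

theorem measurable_param (γ : ℝ) : Measurable (param γ) := by
  unfold param
  fun_prop

/-- `μ_r` is carried by `M_γ`. -/
theorem ae_mem_hypersurface (γ r : ℝ) : ∀ᵐ ζ ∂(mu γ r), ζ ∈ hypersurface γ := by
  have hM : MeasurableSet (hypersurface γ) :=
    measurableSet_eq_fun (by fun_prop) (by fun_prop)
  refine (ae_map_iff (measurable_param γ).aemeasurable hM).2 ?_
  refine (withDensity_absolutelyContinuous _ _).ae_le ?_
  filter_upwards [ae_restrict_mem
    (MeasurableSet.univ.prod (measurableSet_Ioi.prod measurableSet_Ico))] with p hp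
  have h0 : 0 < p.2.1 := hp.2.1
  simp [hypersurface, param, Complex.norm_exp, abs_of_pos h0]

/-- `L²(M_γ, μ_r)`. -/
abbrev L2 (γ r : ℝ) : Type := Lp ℂ 2 (mu γ r)

/-- `L²_k(M_γ, μ_r)`: the elements of `L²(M_γ, μ_r)` of the form `g(s, α) e^{ikθ}`, where
`s = Re ζ₂`, `α = |ζ₁|` and `e^{iθ} = ζ₁ / |ζ₁|`. -/
def L2k (γ r : ℝ) (k : ℕ) : Submodule ℂ (L2 γ r) where
  carrier := {f | ∃ g : ℝ × ℝ → ℂ, Measurable g ∧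
    ∀ᵐ ζ ∂(mu γ r), f ζ = g (ζ.2.re, ‖ζ.1‖) * (ζ.1 / (‖ζ.1‖ : ℂ)) ^ k}
  zero_mem' := by
    refine ⟨0, measurable_zero, ?_⟩
    filter_upwards [Lp.coeFn_zero ℂ 2 (mu γ r)] with ζ hζ
    exact hζ.trans (by simp)
  add_mem' := by
    rintro f₁ f₂ ⟨g₁, hg₁, h₁⟩ ⟨g₂, hg₂, h₂⟩
    refine ⟨g₁ + g₂, hg₁.add hg₂, ?_⟩
    filter_upwards [Lp.coeFn_add f₁ f₂, h₁, h₂] with ζ hζ h₁ h₂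
    rw [hζ, Pi.add_apply, h₁, h₂, Pi.add_apply, add_mul]
  smul_mem' := by
    rintro c f ⟨g, hg, h⟩
    refine ⟨c • g, hg.const_smul c, ?_⟩
    filter_upwards [Lp.coeFn_smul c f, h] with ζ hζ h
    rw [hζ, Pi.smul_apply, h, Pi.smul_apply, smul_eq_mul, smul_eq_mul, mul_assoc]

/-- The factor `ℓ_ρ(z, ζ) = ⟨∂ρ(ζ), ζ - z⟩⁻²` of the Leray kernel of `M_γ`, for the defining
function `ρ(ζ) = |ζ₁|^γ - Im ζ₂`. -/
def kernel (γ : ℝ) (z ζ : ℂ × ℂ) : ℂ :=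
  4 / ((γ : ℂ) * starRingEnd ℂ ζ.1 * ((‖ζ.1‖ ^ (γ - 2) : ℝ) : ℂ) * (ζ.1 - z.1)
    + Complex.I * (ζ.2 - z.2)) ^ 2

/-- The density `(γ² / 16π²) α^{γ-1}` of the Leray-Levi measure
`λ_ρ = (2πi)⁻² ∂ρ ∧ ∂̄∂ρ` of `M_γ` with respect to `ds dα dθ`. -/
def leviDensity (γ α : ℝ) : ℝ :=
  γ ^ 2 / (16 * Real.pi ^ 2) * α ^ (γ - 1)

/-- The integral of `f(ζ) ℓ_ρ(z, ζ) λ_ρ(ζ)` along the circle `θ ↦ (α e^{iθ}, s + i α^γ)`,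
as a density with respect to `ds dα`. -/
def circleIntegrand (γ : ℝ) (f : ℂ × ℂ → ℂ) (z : ℂ × ℂ) (q : ℝ × ℝ) : ℂ :=
  (∫ θ in Ico 0 (2 * Real.pi),
    f (param γ (q.1, q.2, θ)) * kernel γ z (param γ (q.1, q.2, θ))) * (leviDensity γ q.2 : ℂ)

/-- The Leray integral `L f(z) = ∫_{M_γ} f(ζ) ℓ_ρ(z, ζ) λ_ρ(ζ)`. For `z ∈ M_γ` the kernel is
not absolutely integrable at `ζ = z`; the integral is taken in `θ` first, then in `(s, α)`. -/
def transform (γ : ℝ) (f : ℂ × ℂ → ℂ) (z : ℂ × ℂ) : ℂ :=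
  ∫ q in univ ×ˢ Ioi (0 : ℝ), circleIntegrand γ f z q

/-- The Leray integral of `f` converges (absolutely in `(s, α)`) at `μ_r`-almost every `z`. -/
def Converges (γ r : ℝ) (f : ℂ × ℂ → ℂ) : Prop :=
  ∀ᵐ z ∂(mu γ r), IntegrableOn (circleIntegrand γ f z) (univ ×ˢ Ioi (0 : ℝ))

/-- The bounded operator `T` on `L²_k(M_γ, μ_r)` is the sub-Leray operator `L_k`: it is given by
the Leray integral on every `f ∈ L²_k(M_γ, μ_r)` whose Leray integral converges. -/
def IsSubLeray (γ r : ℝ) (k : ℕ) (T : L2k γ r k →L[ℂ] L2k γ r k) : Prop :=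
  ∀ f : L2k γ r k, Converges γ r (f : L2 γ r) →
    ∀ᵐ z ∂(mu γ r), (T f : L2 γ r) z = transform γ (f : L2 γ r) z

/-- The interval `I_k = (-2k - 1, (2k + 2)(γ - 1) + 1)`. -/
def interval (γ : ℝ) (k : ℕ) : Set ℝ :=
  Ioo (-2 * (k : ℝ) - 1) ((2 * (k : ℝ) + 2) * (γ - 1) + 1)

/-- The symbol function `C_{μ_r}(γ, k)`. -/
def symbol (γ r : ℝ) (k : ℕ) : ℝ :=
  Real.Gamma ((2 * k + 1 + r) / γ) * Real.Gamma (2 * k + 2 - (2 * k + 1 + r) / γ)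
    / Real.Gamma (k + 1) ^ 2
    * (γ / 2) ^ (2 * k + 2) * (γ - 1) ^ (-(2 * (k : ℝ) + 2 - (2 * k + 1 + r) / γ))

end Leray

end

open MeasureTheory Set

noncomputable section

namespace Leray

/-! On functions g(s, α)e^{ikθ} the Leray integral reduces to one over the half-plane. With t = Re
z₂ and β = |z₁|, the expression squared in the denominator is A - u e^{-iθ}, where A = (γ-1)α^γ +
β^γ + i(s-t) and u = γα^{γ-1}z₁. The strict weighted arithmetic-geometric inequality gives |u| < Re
A for α ≠ β, so a geometric series isolates the k-th Fourier coefficient, a multiple of u^k /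
A^{k+2} (`integral_Ico_exp_mul_inv_sq`, `circleIntegrand_eq`).

Since Re A > 0, A^{-(k+2)} is the Laplace transform of ξ^{k+1}/(k+1)!, and e^{-Aξ} factors into a
function of (s, α) and one of (t, β). Sharing ξ^{k+1} between the two factors writes the operator as
c V U*. Here V and U superpose waves e^{iξs} over ξ > 0, with profiles α^k e^{-ξα^γ} and α^d
e^{-(γ-1)ξα^γ}, where d = (γ-1)(k+1) - r. The powers of ξ are shared so that each profile has a norm
in L²(α^r dα) independent of ξ. Plancherel in s then makes V and U multiples of isometries from
L²(0, ∞) into L²_k (`norm_wave`), and ‖c V U*‖ is exactly the product of the constants, each profile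
contributing one Gamma factor (`norm_subLeray`). The norms are finite when 2k + r > -1 and 2d + r >
-1, that is, when r lies in the interval.

Conversely, near a point where A is real and positive, Re A^{-(k+2)} is bounded below, so
nonnegative test functions see no cancellation. Testing on boxes bounds ∫α^{2d+r} · ∫β^{2k+r} by a
multiple of ‖T‖² (`lintegral_mul_lintegral_le`). Boxes with (α, β) near (1, 0) and (0, 1) force each
power to be integrable at 0. -/

/-! ### Plancherel for Fourier integrals on the line. -/

open FourierTransform in
/-- Plancherel's theorem for the Fourier integral of a function in `L¹ ∩ L²`. -/
theorem lintegral_enorm_fourier_sq {F : ℝ → ℂ} (h₁ : Integrable F) (h₂ : MemLp F 2) :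
    ∫⁻ t, ‖𝓕 F t‖ₑ ^ 2 = ∫⁻ x, ‖F x‖ₑ ^ 2 := by
  set f : Lp ℂ 2 (volume : Measure ℝ) := h₂.toLp F with hf
  have hcont : Continuous (𝓕 F) :=
    VectorFourier.fourierIntegral_continuous Real.continuous_fourierChar
      (by exact continuous_inner) h₁
  have hae : ((𝓕 f : Lp ℂ 2 (volume : Measure ℝ)) : ℝ → ℂ) =ᵐ[volume] 𝓕 F := by
    -- The L² Fourier transform and the Fourier integral agree as distributions: against a test
    -- function, both move the transform onto that function.
    refine ae_eq_of_integral_contDiff_smul_eq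
      ((Lp.memLp _).locallyIntegrable (by norm_num)) hcont.locallyIntegrable ?_
    intro g hg hgc
    have hgc' : HasCompactSupport fun x => (g x : ℂ) :=
      hgc.comp_left (g := fun x : ℝ => (x : ℂ)) Complex.ofReal_zero
    let φ : SchwartzMap ℝ ℂ := hgc'.toSchwartzMap (Complex.ofRealCLM.contDiff.comp hg)
    have hφ (x : ℝ) : φ x = (g x : ℂ) := rfl
    have e1 := DFunLike.congr_fun (Lp.fourier_toTemperedDistribution_eq f) φ
    rw [TemperedDistribution.fourier_apply, Lp.toTemperedDistribution_apply,
      Lp.toTemperedDistribution_apply] at e1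
    have e2 : ∫ x, (𝓕 φ) x • f x = ∫ x, 𝓕 (φ : ℝ → ℂ) x • F x := by
      refine integral_congr_ae ?_
      filter_upwards [h₂.coeFn_toLp] with x hx
      rw [hf, hx, SchwartzMap.fourier_coe]
    have e3 : ∫ x, 𝓕 (φ : ℝ → ℂ) x • F x = ∫ x, φ x • 𝓕 F x :=
      VectorFourier.integral_fourierIntegral_smul_eq_flip
        (L := innerₗ ℝ) Real.continuous_fourierChar (by exact continuous_inner) φ.integrable h₁ |>.trans
        (by simp only [flip_innerₗ]; rfl)
    have e4 := e1.symm.trans (e2.trans e3)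
    simpa [hφ] using e4
  have n1 (G : Lp ℂ 2 (volume : Measure ℝ)) : ‖G‖ₑ ^ 2 = ∫⁻ x, ‖G x‖ₑ ^ 2 := by
    rw [Lp.enorm_def]
    simpa using eLpNorm_nnreal_pow_eq_lintegral (f := G) (μ := volume) (p := 2) two_ne_zero
  have n2 : ‖(𝓕 f : Lp ℂ 2 (volume : Measure ℝ))‖ₑ = ‖f‖ₑ := by
    rw [← ofReal_norm, ← ofReal_norm, Lp.norm_fourier_eq]
  calc ∫⁻ t, ‖𝓕 F t‖ₑ ^ 2 = ‖(𝓕 f : Lp ℂ 2 (volume : Measure ℝ))‖ₑ ^ 2 := by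
        rw [n1]
        exact lintegral_congr_ae (by filter_upwards [hae] with x hx; rw [hx])
    _ = ∫⁻ x, ‖F x‖ₑ ^ 2 := by
        rw [n2, n1]
        exact lintegral_congr_ae (by filter_upwards [h₂.coeFn_toLp] with x hx; rw [hf, hx])

/-- Plancherel's theorem for the unnormalized Fourier integral. -/
theorem lintegral_enorm_integral_mul_exp_sq {F : ℝ → ℂ} (h₁ : Integrable F) (h₂ : MemLp F 2) :
    ∫⁻ t : ℝ, ‖∫ x, F x * Complex.exp (x * t * Complex.I)‖ₑ ^ 2
      = ENNReal.ofReal (2 * Real.pi) * ∫⁻ x, ‖F x‖ₑ ^ 2 := by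
  have hpi : (-(2 * Real.pi)) ≠ 0 := by have := Real.pi_pos; linarith
  rw [← lintegral_enorm_fourier_sq h₁ h₂]
  set G : ℝ → ENNReal := fun t => ‖∫ x, F x * Complex.exp (x * t * Complex.I)‖ₑ ^ 2 with hG
  -- `𝓕` uses the character e^{-2πixt}; rescaling t by -2π converts it to e^{ixt} and produces the
  -- factor 2π.
  have hscale : ∫⁻ t, G t = ENNReal.ofReal (2 * Real.pi) * ∫⁻ t, G (-(2 * Real.pi) * t) := by
    conv_lhs => rw [← Real.smul_map_volume_mul_left hpi]
    rw [lintegral_smul_measure, abs_neg, abs_of_pos Real.two_pi_pos, smul_eq_mul]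
    congr 1
    exact (Homeomorph.mulLeft₀ _ hpi).measurableEmbedding.lintegral_map _
  rw [hscale]
  congr 1
  refine lintegral_congr fun t => ?_
  rw [Real.fourier_eq']
  simp only [hG]
  congr 2
  refine integral_congr_ae (Filter.Eventually.of_forall fun x => ?_)
  simp only [smul_eq_mul, RCLike.inner_apply, conj_trivial]
  rw [mul_comm]
  congr 2
  push_cast
  ring

/-! ### Fourier coefficients along circles. -/

theorem integral_Ico_exp_int_mul (m : ℤ) :
    ∫ θ in Ico 0 (2 * Real.pi), Complex.exp (m * θ * Complex.I) = 
      if m = 0 then (2 * Real.pi : ℂ) else 0 := by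
  rw [integral_Ico_eq_integral_Ioc, ← intervalIntegral.integral_of_le Real.two_pi_pos.le]
  split_ifs with h
  · simp [h]
  · have hm : (m : ℂ) * Complex.I ≠ 0 := mul_ne_zero (by exact_mod_cast h) Complex.I_ne_zero
    have := integral_exp_mul_complex (a := 0) (b := 2 * Real.pi) hm
    have h2 : Complex.exp (m * Complex.I * ((2 * Real.pi : ℝ) : ℂ)) = 1 := by
      rw [← Complex.exp_int_mul_two_pi_mul_I m]; congr 1; push_cast; ring
    rw [h2] at this
    simp only [Complex.ofReal_zero, mul_zero, Complex.exp_zero, sub_self, zero_div] at this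
    rw [← this]
    congr 1 with θ
    congr 1; ring

/-- The `k`-th Fourier coefficient of `θ ↦ 4 / (A - u e^{-iθ})²`. -/
theorem integral_Ico_exp_mul_inv_sq (k : ℕ) {A u : ℂ} (h : ‖u‖ < ‖A‖) :
    ∫ θ in Ico 0 (2 * Real.pi), Complex.exp (θ * Complex.I) ^ k
        * (4 / (A - u * Complex.exp (-(θ * Complex.I))) ^ 2)
      = 8 * Real.pi * (k + 1) * u ^ k / A ^ (k + 2) := by
  have hA : A ≠ 0 := norm_pos_iff.1 ((norm_nonneg u).trans_lt h)
  set x := u / A with hx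
  have hx1 : ‖x‖ < 1 := by rw [hx, norm_div, div_lt_one (norm_pos_iff.2 hA)]; exact h
  -- The n-th term of 1/(1 - xw)² = ∑ (n+1)(xw)^n with w = e^{-iθ}, multiplied by 4e^{ikθ}/A²; only
  -- n = k survives integration.
  set F : ℕ → ℝ → ℂ := fun n θ =>
    (4 / A ^ 2 * ((n + 1) * x ^ n)) * Complex.exp (((k - n : ℤ) : ℂ) * θ * Complex.I) with hF
  have hnorm (n : ℕ) (θ : ℝ) : ‖F n θ‖ = ‖4 / A ^ 2‖ * ((n + 1) * ‖x‖ ^ n) := by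
    rw [hF]
    simp only [norm_mul, norm_pow]
    have : ‖Complex.exp (((k - n : ℤ) : ℂ) * θ * Complex.I)‖ = 1 := by
      have := Complex.norm_exp_ofReal_mul_I ((k - n : ℤ) * θ)
      rw [← this]; push_cast; rfl
    rw [this, mul_one]
    congr 2
    have := Complex.norm_natCast (n + 1)
    push_cast at this ⊢
    exact this
  have hint (n : ℕ) : Integrable (F n) (volume.restrict (Ico 0 (2 * Real.pi))) := by
    refine (Continuous.integrableOn_Icc ?_).mono_set Ico_subset_Icc_self
    rw [hF]; fun_prop
  have hsum : Summable fun n => ∫ θ in Ico 0 (2 * Real.pi), ‖F n θ‖ := by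
    simp_rw [hnorm, setIntegral_const]
    refine Summable.const_smul _ (Summable.mul_left _ ?_)
    have := (hasSum_choose_mul_geometric_of_norm_lt_one 1 (r := ‖x‖) (by simpa using hx1)).summable
    simpa using this
  have key := hasSum_integral_of_summable_integral_norm hint hsum
  have hterm (θ : ℝ) : ∑' n, F n θ = Complex.exp (θ * Complex.I) ^ k
        * (4 / (A - u * Complex.exp (-(θ * Complex.I))) ^ 2) := by
    set w := Complex.exp (-(θ * Complex.I)) with hw
    have hw1 : ‖w‖ = 1 := by
      have := Complex.norm_exp_ofReal_mul_I (-θ)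
      rw [hw, ← this]; push_cast; ring_nf
    have hxw : ‖x * w‖ < 1 := by rw [norm_mul, hw1, mul_one]; exact hx1
    have hs := (hasSum_choose_mul_geometric_of_norm_lt_one 1 hxw).mul_left
      (Complex.exp (θ * Complex.I) ^ k * (4 / A ^ 2))
    have e : (fun n : ℕ => F n θ) = fun n : ℕ => Complex.exp (θ * Complex.I) ^ k * (4 / A ^ 2) *
        (((n + 1).choose 1 : ℕ) * (x * w) ^ n) := by
      ext n
      rw [hF, hw]
      simp only [Nat.choose_one_right, mul_pow, ← Complex.exp_nat_mul]
      have : Complex.exp (((k - n : ℤ) : ℂ) * θ * Complex.I)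
          = Complex.exp (k * (θ * Complex.I)) * Complex.exp (n * -(θ * Complex.I)) := by
        rw [← Complex.exp_add]; congr 1; push_cast; ring
      rw [this]
      push_cast
      ring
    rw [e, hs.tsum_eq, mul_assoc]
    congr 1
    have : A - u * w = A * (1 - x * w) := by rw [hx]; field_simp
    rw [this, mul_pow]
    field_simp
  have hI (n : ℕ) : ∫ θ in Ico 0 (2 * Real.pi), F n θ
      = if n = k then 8 * Real.pi * (k + 1) * u ^ k / A ^ (k + 2) else 0 := by
    rw [hF]
    simp only
    rw [integral_const_mul, integral_Ico_exp_int_mul]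
    by_cases hn : n = k
    · subst hn
      simp only [sub_self, if_true]
      rw [hx, div_pow]
      field_simp
      ring
    · rw [if_neg (by omega), if_neg hn, mul_zero]
  simp_rw [hterm, hI] at key
  exact key.unique (hasSum_ite_eq k _)

/-! ### Laplace transforms of powers. -/

theorem integrableOn_pow_mul_cexp (m : ℕ) {A : ℂ} (hA : 0 < A.re) :
    IntegrableOn (fun x : ℝ => (x : ℂ) ^ m * Complex.exp (-(A * x))) (Ioi 0) := by
  have h := integrableOn_rpow_mul_exp_neg_mul_rpow (s := m) (p := 1) (b := A.re)
    (by have : (0 : ℝ) ≤ m := m.cast_nonneg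
        linarith) (by norm_num) hA
  refine Integrable.mono h (by fun_prop) ?_
  refine (ae_restrict_mem measurableSet_Ioi).mono fun x hx => ?_
  have hx : 0 < x := hx
  simp [Complex.norm_exp, abs_of_pos hx]

/-- The Laplace transform of a power. -/
theorem integral_pow_mul_cexp (m : ℕ) {A : ℂ} (hA : 0 < A.re) :
    ∫ x : ℝ in Ioi 0, (x : ℂ) ^ m * Complex.exp (-(A * x)) = m.factorial / A ^ (m + 1) := by
  have hA0 : A ≠ 0 := fun h => by simp [h] at hA
  induction m with
  | zero =>
    have := integral_exp_mul_complex_Ioi (a := -A) (by simpa using hA) 0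
    simpa [neg_mul] using this
  | succ m ih =>
    have hd (x : ℝ) : HasDerivAt (fun x : ℝ => (x : ℂ) ^ (m + 1) * Complex.exp (-(A * x)))
        ((m + 1) * ((x : ℂ) ^ m * Complex.exp (-(A * x)))
          - A * ((x : ℂ) ^ (m + 1) * Complex.exp (-(A * x)))) x := by
      have h1 : HasDerivAt (fun z : ℂ => z ^ (m + 1) * Complex.exp (-(A * z)))
          (((m + 1 : ℕ) : ℂ) * (x : ℂ) ^ m * Complex.exp (-(A * x))
            + (x : ℂ) ^ (m + 1) * (Complex.exp (-(A * x)) * (-(A * 1)))) x :=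
        (hasDerivAt_pow (m + 1) (x : ℂ)).mul (((hasDerivAt_id (x : ℂ)).const_mul A).neg.cexp)
      convert! h1.comp_ofReal using 1
      push_cast
      ring
    have hlim : Filter.Tendsto (fun x : ℝ => (x : ℂ) ^ (m + 1) * Complex.exp (-(A * x)))
        Filter.atTop (nhds 0) := by
      rw [tendsto_zero_iff_norm_tendsto_zero]
      refine (tendsto_rpow_mul_exp_neg_mul_atTop_nhds_zero (m + 1) A.re hA).congr' ?_
      filter_upwards [Filter.eventually_gt_atTop 0] with x hx
      simp only [norm_mul, norm_pow, Complex.norm_real, Complex.norm_exp, Real.norm_eq_abs,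
        abs_of_pos hx]
      rw [← Real.rpow_natCast]
      simp
    have := integral_Ioi_of_hasDerivAt_of_tendsto' (a := 0) (fun x _ => hd x)
      (((integrableOn_pow_mul_cexp m hA).const_mul _).sub
        ((integrableOn_pow_mul_cexp (m + 1) hA).const_mul _)) hlim
    rw [integral_sub ((integrableOn_pow_mul_cexp m hA).const_mul _)
      ((integrableOn_pow_mul_cexp (m + 1) hA).const_mul _), integral_const_mul,
      integral_const_mul, ih] at this
    simp only [Complex.ofReal_zero, ne_eq, Nat.succ_ne_zero, not_false_eq_true, zero_pow,
      zero_mul, sub_zero] at this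
    rw [sub_eq_zero] at this
    rw [eq_div_iff (pow_ne_zero _ hA0), pow_succ, ← mul_assoc, mul_right_comm, mul_comm _ A, ← this,
      Nat.factorial_succ]
    push_cast
    field_simp

/-! ### The measures on `M_γ`, fibred into circles. -/

/-- Lebesgue measure `ds dα` on the half-plane `α > 0`. -/
def halfPlane : Measure (ℝ × ℝ) :=
  volume.restrict (univ ×ˢ Ioi (0 : ℝ))

/-- Lebesgue measure `dθ` on `[0, 2π)`. -/
def angle : Measure ℝ :=
  volume.restrict (Ico 0 (2 * Real.pi))

/-- The measure `α^r ds dα` on the half-plane `α > 0`. -/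
def weighted (r : ℝ) : Measure (ℝ × ℝ) :=
  halfPlane.withDensity fun q => ENNReal.ofReal (q.2 ^ r)

instance : SFinite halfPlane := by unfold halfPlane; infer_instance
instance : IsFiniteMeasure angle := by unfold angle; infer_instance
instance (r : ℝ) : SFinite (weighted r) := by unfold weighted; infer_instance

theorem measurable_weight (r : ℝ) : Measurable fun q : ℝ × ℝ => ENNReal.ofReal (q.2 ^ r) := by
  fun_prop

theorem ae_halfPlane_pos : ∀ᵐ q ∂halfPlane, 0 < q.2 :=
  (ae_restrict_mem (MeasurableSet.univ.prod measurableSet_Ioi)).mono fun _ hq => hq.2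

theorem halfPlane_eq_prod :
    halfPlane = (volume : Measure ℝ).prod (volume.restrict (Ioi (0 : ℝ))) := by
  rw [halfPlane, Measure.volume_eq_prod, ← Measure.prod_restrict, Measure.restrict_univ]

theorem angle_univ : angle univ = ENNReal.ofReal (2 * Real.pi) := by
  simp [angle]

/-- The density α^r is positive on the half-plane, so null sets do not depend on r. -/
theorem ae_weighted_iff {r : ℝ} {P : ℝ × ℝ → Prop} :
    (∀ᵐ q ∂weighted r, P q) ↔ ∀ᵐ q ∂halfPlane, P q := by
  rw [weighted, ae_withDensity_iff (measurable_weight r)]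
  refine ⟨fun h => ?_, fun h => h.mono fun q hq _ => hq⟩
  filter_upwards [h, ae_halfPlane_pos] with q hq hpos
  exact hq (by simpa using Real.rpow_pos_of_pos hpos r)

/-- The parametrization of `M_γ`, with the variables grouped as `((s, α), θ)`. -/
def paramPair (γ : ℝ) (p : (ℝ × ℝ) × ℝ) : ℂ × ℂ :=
  param γ (p.1.1, p.1.2, p.2)

theorem measurable_paramPair (γ : ℝ) : Measurable (paramPair γ) :=
  (measurable_param γ).comp (by fun_prop)

/-- Splitting θ off as the second factor of a product lets Fubini produce the inner θ-integral of
`circleIntegrand`. -/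
theorem mu_eq_map (γ r : ℝ) : mu γ r = ((weighted r).prod angle).map (paramPair γ) := by
  have hpres : MeasurePreserving MeasurableEquiv.prodAssoc (halfPlane.prod angle)
      (volume.restrict ((univ : Set ℝ) ×ˢ (Ioi (0 : ℝ) ×ˢ Ico 0 (2 * Real.pi)))) := by
    have := (volume_preserving_prodAssoc (α₁ := ℝ) (β₁ := ℝ) (γ₁ := ℝ)).restrict_preimage
      (MeasurableSet.univ.prod
        ((measurableSet_Ioi (a := (0 : ℝ))).prod (measurableSet_Ico (a := 0) (b := 2 * Real.pi))))
    convert! this using 1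
    rw [halfPlane, angle, Measure.prod_restrict]
    congr 1
    ext p
    simp [MeasurableEquiv.prodAssoc]
  refine Measure.ext_of_lintegral _ fun f hf => ?_
  have hf1 : Measurable fun p => f (param γ p) := hf.comp (measurable_param γ)
  have hf2 : Measurable fun p => f (paramPair γ p) := hf.comp (measurable_paramPair γ)
  rw [mu, paramMeasure, lintegral_map hf (measurable_param γ),
    lintegral_map hf (measurable_paramPair γ),
    weighted, prod_withDensity_left (measurable_weight r),
    lintegral_withDensity_eq_lintegral_mul _ (by fun_prop) hf1,
    lintegral_withDensity_eq_lintegral_mul _ (by fun_prop) hf2,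
    ← hpres.lintegral_comp (by
      exact Measurable.mul (by fun_prop) hf1)]
  rfl

theorem ae_ae_of_ae_mu {γ r : ℝ} {P : ℂ × ℂ → Prop} (h : ∀ᵐ ζ ∂mu γ r, P ζ) :
    ∀ᵐ q ∂halfPlane, ∀ᵐ θ ∂angle, P (param γ (q.1, q.2, θ)) := by
  rw [mu_eq_map] at h
  exact ae_weighted_iff.1 (Measure.ae_ae_of_ae_prod
    (ae_of_ae_map (measurable_paramPair γ).aemeasurable h))

theorem lintegral_mu {γ r : ℝ} {f : ℂ × ℂ → ENNReal} (hf : Measurable f) :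
    ∫⁻ ζ, f ζ ∂mu γ r = ∫⁻ q, ∫⁻ θ, f (param γ (q.1, q.2, θ)) ∂angle ∂weighted r := by
  have hf2 : Measurable fun p => f (paramPair γ p) := hf.comp (measurable_paramPair γ)
  rw [mu_eq_map, lintegral_map hf (measurable_paramPair γ), lintegral_prod _ hf2.aemeasurable]
  rfl

theorem norm_param_fst {γ : ℝ} {q : ℝ × ℝ} (hq : 0 < q.2) (θ : ℝ) :
    ‖(param γ (q.1, q.2, θ)).1‖ = q.2 := by
  simp [param, Complex.norm_exp, abs_of_pos hq]

theorem param_snd_re (γ : ℝ) (q : ℝ × ℝ) (θ : ℝ) : (param γ (q.1, q.2, θ)).2.re = q.1 := by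
  simp [param]

theorem param_fst_div_norm {γ : ℝ} {q : ℝ × ℝ} (hq : 0 < q.2) (θ : ℝ) :
    (param γ (q.1, q.2, θ)).1 / (‖(param γ (q.1, q.2, θ)).1‖ : ℂ)
      = Complex.exp (θ * Complex.I) := by
  have : (q.2 : ℂ) ≠ 0 := by exact_mod_cast hq.ne'
  rw [norm_param_fst hq]
  simp only [param]
  field_simp

theorem lintegral_weighted {r : ℝ} {G : ℝ × ℝ → ENNReal} (hG : Measurable G) :
    ∫⁻ q, G q ∂weighted r
      = ∫⁻ α in Ioi 0, ENNReal.ofReal (α ^ r) * ∫⁻ s, G (s, α) := by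
  rw [weighted, lintegral_withDensity_eq_lintegral_mul _ (measurable_weight r) hG,
    halfPlane_eq_prod, lintegral_prod_symm' _ ((measurable_weight r).mul hG)]
  refine lintegral_congr fun α => ?_
  simp only [Pi.mul_apply]
  exact lintegral_const_mul _ (by fun_prop)

theorem lintegral_mu_radial {γ r : ℝ} {G : ℝ × ℝ → ENNReal} (hG : Measurable G) :
    ∫⁻ ζ, G (ζ.2.re, ‖ζ.1‖) ∂mu γ r
      = ENNReal.ofReal (2 * Real.pi) * ∫⁻ q, G q ∂weighted r := by
  rw [lintegral_mu (by fun_prop), ← lintegral_const_mul _ hG]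
  refine lintegral_congr_ae ?_
  filter_upwards [ae_weighted_iff.2 ae_halfPlane_pos] with q hq
  simp [norm_param_fst hq, param_snd_re, angle_univ, mul_comm]

/-- Fubini with θ innermost. It turns an L² pairing on the hypersurface into the iterated integral
in which the Leray transform is defined. -/
theorem integrable_integral_mu {γ r : ℝ} {F : ℂ × ℂ → ℂ} (hF : Integrable F (mu γ r)) :
    Integrable (fun q : ℝ × ℝ => (q.2 ^ r : ℝ) • ∫ θ, F (param γ (q.1, q.2, θ)) ∂angle) halfPlane ∧
    ∫ q, (q.2 ^ r : ℝ) • ∫ θ, F (param γ (q.1, q.2, θ)) ∂angle ∂halfPlane = ∫ ζ, F ζ ∂mu γ r := by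
  have h2 : Integrable (fun p => F (paramPair γ p)) ((weighted r).prod angle) := by
    rw [mu_eq_map] at hF
    exact hF.comp_measurable (measurable_paramPair γ)
  have h3 := h2.integral_prod_left
  have hlt : ∀ᵐ q ∂halfPlane, ENNReal.ofReal (q.2 ^ r) < ⊤ := by simp
  have hpos : ∀ᵐ q ∂halfPlane, (ENNReal.ofReal (q.2 ^ r)).toReal = q.2 ^ r := by
    filter_upwards [ae_halfPlane_pos] with q hq
    exact ENNReal.toReal_ofReal (Real.rpow_nonneg hq.le r)
  constructor
  · rw [weighted, integrable_withDensity_iff_integrable_smul' (measurable_weight r) hlt] at h3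
    refine h3.congr ?_
    filter_upwards [hpos] with q hq
    rw [hq]; rfl
  · have e : ∫ ζ, F ζ ∂mu γ r = ∫ p, F (paramPair γ p) ∂((weighted r).prod angle) := by
      rw [mu_eq_map] at hF ⊢
      exact integral_map (measurable_paramPair γ).aemeasurable hF.1
    rw [e, integral_prod _ h2, weighted,
      integral_withDensity_eq_integral_toReal_smul (measurable_weight r) hlt]
    refine integral_congr_ae ?_
    filter_upwards [hpos] with q hq
    rw [hq]; rfl

theorem ae_mu_norm_pos (γ r : ℝ) : ∀ᵐ ζ ∂mu γ r, 0 < ‖ζ.1‖ := by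
  rw [mu_eq_map, ae_map_iff (measurable_paramPair γ).aemeasurable
    (measurableSet_lt measurable_const (by fun_prop))]
  have h : ∀ᵐ q ∂weighted r, 0 < q.2 := ae_weighted_iff.2 ae_halfPlane_pos
  filter_upwards [Measure.quasiMeasurePreserving_fst.ae h] with p hp
  exact (norm_param_fst (γ := γ) hp p.2).symm ▸ hp

/-- The squared norm in `L²`, as a Lebesgue integral. -/
theorem enorm_sq_eq_lintegral {X : Type*} [MeasurableSpace X] {μ : Measure X} (f : Lp ℂ 2 μ) :
    ‖f‖ₑ ^ 2 = ∫⁻ x, ‖f x‖ₑ ^ 2 ∂μ := by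
  rw [Lp.enorm_def]
  simpa using eLpNorm_nnreal_pow_eq_lintegral (f := f) (μ := μ) (p := 2) two_ne_zero

/-! ### Wave superpositions and their L² norms. -/

section

variable {γ r c j : ℝ}

/-- Lebesgue measure on the frequencies `ξ > 0`. -/
abbrev freq : Measure ℝ := volume.restrict (Ioi (0 : ℝ))

/-- The profile `α^j ξ^{(2j+r+1)/(2γ)} e^{-c ξ α^γ}`; the power of `ξ` makes its norm in
`L²(α^r dα)` independent of `ξ`. -/
def profile (γ r c j ξ α : ℝ) : ℝ :=
  α ^ j * ξ ^ ((2 * j + r + 1) / (2 * γ)) * Real.exp (-(c * ξ * α ^ γ))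

/-- The square of the norm of the profile in `L²(α^r dα)`. -/
def profileNormSq (γ r c j : ℝ) : ℝ :=
  1 / γ * (2 * c) ^ (-((2 * j + r + 1) / γ)) * Real.Gamma ((2 * j + r + 1) / γ)


theorem measurable_profile : Measurable fun p : ℝ × ℝ => profile γ r c j p.1 p.2 := by
  unfold profile; fun_prop

theorem measurable_profile_left (α : ℝ) : Measurable fun ξ => profile γ r c j ξ α := by
  unfold profile; fun_prop

theorem measurable_profile_right (ξ : ℝ) : Measurable fun α => profile γ r c j ξ α := by
  unfold profile; fun_prop

theorem profile_nonneg {ξ α : ℝ} (hξ : 0 < ξ) (hα : 0 < α) : 0 ≤ profile γ r c j ξ α := by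
  unfold profile; positivity

/-- For fixed α the profile is bounded in ξ, because ξ^a e^{-mξ} is. This keeps h · profile in L²,
as Plancherel requires. -/
theorem profile_le (hγ : 0 < γ) (hc : 0 < c) (hj : 0 < 2 * j + r + 1) {α ξ : ℝ} (hα : 0 < α)
    (hξ : 0 < ξ) :
    profile γ r c j ξ α ≤ α ^ j * ((2 * j + r + 1) / (2 * γ) / (c * α ^ γ)) ^
      ((2 * j + r + 1) / (2 * γ)) := by
  unfold profile
  set a := (2 * j + r + 1) / (2 * γ) with ha
  have ha0 : 0 < a := by positivity
  have hm : 0 < c * α ^ γ := by positivity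
  -- Scaled so that y^a ≤ (e^y)^a is exactly a bound by e^{cξα^γ}.
  set y := c * α ^ γ * ξ / a with hy
  have hy0 : 0 < y := by positivity
  have h1 : y ^ a ≤ Real.exp (c * ξ * α ^ γ) := by
    calc y ^ a ≤ (Real.exp y) ^ a :=
          Real.rpow_le_rpow hy0.le (by linarith [Real.add_one_le_exp y]) ha0.le
      _ = Real.exp (c * ξ * α ^ γ) := by
          rw [← Real.exp_mul, hy]; congr 1; field_simp
  have h2 : ξ = a / (c * α ^ γ) * y := by rw [hy]; field_simp
  have h3 : ξ ^ a = (a / (c * α ^ γ)) ^ a * y ^ a := by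
    conv_lhs => rw [h2]
    rw [Real.mul_rpow (by positivity) hy0.le]
  rw [mul_assoc]
  refine mul_le_mul_of_nonneg_left ?_ (by positivity)
  rw [h3, mul_assoc, Real.exp_neg]
  refine mul_le_of_le_one_right (by positivity) ?_
  rw [← div_eq_mul_inv, div_le_one (Real.exp_pos _)]
  exact h1

theorem profile_sq {ξ α : ℝ} (hξ : 0 < ξ) (hα : 0 < α) :
    profile γ r c j ξ α ^ 2 =
      α ^ (2 * j) * (ξ ^ ((2 * j + r + 1) / γ) * Real.exp (-(2 * c * α ^ γ) * ξ)) := by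
  unfold profile
  rw [mul_pow, mul_pow, ← Real.rpow_mul_natCast hα.le, ← Real.rpow_mul_natCast hξ.le,
    ← Real.exp_nat_mul]
  rw [show (2 * j + r + 1) / (2 * γ) * ((2 : ℕ) : ℝ) = (2 * j + r + 1) / γ by
    push_cast; rw [mul_comm 2 γ, ← div_div]; ring]
  rw [show ((2 : ℕ) : ℝ) * -(c * ξ * α ^ γ) = -(2 * c * α ^ γ) * ξ by push_cast; ring]
  push_cast
  rw [mul_comm j 2]; ring

theorem memLp_profile (hγ : 0 < γ) (hc : 0 < c) (hj : 0 < 2 * j + r + 1) {α : ℝ} (hα : 0 < α) :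
    MemLp (fun ξ => profile γ r c j ξ α) 2 freq := by
  rw [memLp_two_iff_integrable_sq (measurable_profile_left α).aestronglyMeasurable]
  have h := integrableOn_rpow_mul_exp_neg_mul_rpow (s := (2 * j + r + 1) / γ) (p := 1)
    (b := 2 * c * α ^ γ) (by have : 0 < (2 * j + r + 1) / γ := by positivity
                             linarith) (by norm_num) (by positivity)
  refine (h.const_mul (α ^ (2 * j))).congr ?_
  filter_upwards [ae_restrict_mem measurableSet_Ioi] with ξ hξ
  rw [profile_sq hξ hα, Real.rpow_one]

/-- By scaling, ∫ α^{2j+r} e^{-2cξα^γ} dα is a constant times ξ^{-(2j+r+1)/γ}, which the squared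
power of ξ in the profile cancels. -/
theorem lintegral_profile_sq (hγ : 0 < γ) (hc : 0 < c) (hj : 0 < 2 * j + r + 1) {ξ : ℝ}
    (hξ : 0 < ξ) :
    ∫⁻ α in Ioi 0, ENNReal.ofReal (α ^ r) * ‖profile γ r c j ξ α‖ₑ ^ 2
      = ENNReal.ofReal (profileNormSq γ r c j) := by
  have hq : -1 < 2 * j + r := by linarith
  have hb : 0 < 2 * c * ξ := by positivity
  have hint := integrableOn_rpow_mul_exp_neg_mul_rpow (s := 2 * j + r) (p := γ) hq hγ hb
  have hval := integral_rpow_mul_exp_neg_mul_rpow hγ hq hb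
  have e : ∀ α ∈ Ioi (0 : ℝ), ENNReal.ofReal (α ^ r) * ‖profile γ r c j ξ α‖ₑ ^ 2 =
      ENNReal.ofReal (ξ ^ ((2 * j + r + 1) / γ) *
        (α ^ (2 * j + r) * Real.exp (-(2 * c * ξ) * α ^ γ))) := by
    intro α hα
    have hα : 0 < α := hα
    rw [Real.enorm_of_nonneg (profile_nonneg hξ hα), ← ENNReal.ofReal_pow (profile_nonneg hξ hα),
      ← ENNReal.ofReal_mul (by positivity), profile_sq hξ hα, Real.rpow_add hα]
    congr 1
    rw [show -(2 * c * α ^ γ) * ξ = -(2 * c * ξ) * α ^ γ by ring]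
    ring
  rw [setLIntegral_congr_fun measurableSet_Ioi e, ← ofReal_integral_eq_lintegral_ofReal
    (hint.const_mul _)]
  · rw [integral_const_mul, hval, profileNormSq]
    congr 1
    rw [Real.mul_rpow (by positivity) hξ.le, neg_div, Real.rpow_neg hξ.le]
    have : ξ ^ ((2 * j + r + 1) / γ) ≠ 0 := (Real.rpow_pos_of_pos hξ _).ne'
    field_simp
  · filter_upwards [ae_restrict_mem measurableSet_Ioi] with α hα
    have hα : 0 < α := hα
    simp only [Pi.zero_apply]
    positivity

/-- The superposition `∫ h(ξ) α^j ξ^a e^{-c ξ α^γ} e^{iξs} dξ` of waves in `s`. -/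
def superpose (γ r c j : ℝ) (h : ℝ → ℂ) (q : ℝ × ℝ) : ℂ :=
  ∫ ξ, h ξ * (profile γ r c j ξ q.2 : ℂ) * Complex.exp (ξ * q.1 * Complex.I) ∂freq

theorem measurable_superpose {h : ℝ → ℂ} (hh : Measurable h) :
    Measurable (superpose γ r c j h) := by
  unfold superpose
  have hp : Measurable fun p : (ℝ × ℝ) × ℝ => profile γ r c j p.2 p.1.2 :=
    measurable_profile.comp (by fun_prop : Measurable fun p : (ℝ × ℝ) × ℝ => (p.2, p.1.2))
  have : StronglyMeasurable fun p : (ℝ × ℝ) × ℝ => h p.2 * (profile γ r c j p.2 p.1.2 : ℂ) *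
      Complex.exp (p.2 * p.1.1 * Complex.I) := by
    refine Measurable.stronglyMeasurable ?_
    exact ((hh.comp measurable_snd).mul (Complex.measurable_ofReal.comp hp)).mul (by fun_prop)
  exact (this.integral_prod_right (ν := freq)).measurable

theorem norm_cexp_mul_I (x y : ℝ) : ‖Complex.exp (x * y * Complex.I)‖ = 1 := by
  rw [← Complex.ofReal_mul, Complex.norm_exp_ofReal_mul_I]

theorem integrable_superpose (hγ : 0 < γ) (hc : 0 < c) (hj : 0 < 2 * j + r + 1) {h : ℝ → ℂ}
    (hh : MemLp h 2 freq) {α : ℝ} (hα : 0 < α) (s : ℝ) :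
    Integrable (fun ξ => h ξ * (profile γ r c j ξ α : ℂ) * Complex.exp (ξ * s * Complex.I))
      freq := by
  have h1 : Integrable (fun ξ => h ξ * (profile γ r c j ξ α : ℂ)) freq :=
    hh.integrable_mul (memLp_profile hγ hc hj hα).ofReal
  exact h1.mul_bdd (c := 1) (by fun_prop)
    (Filter.Eventually.of_forall fun ξ => (norm_cexp_mul_I ξ s).le)

/-- At fixed α the superposition is a Fourier integral in s of h · profile, extended by zero to
negative frequencies; Plancherel applies. -/
theorem lintegral_superpose_sq (hγ : 0 < γ) (hc : 0 < c) (hj : 0 < 2 * j + r + 1) {h : ℝ → ℂ}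
    (hh : MemLp h 2 freq) {α : ℝ} (hα : 0 < α) :
    ∫⁻ s, ‖superpose γ r c j h (s, α)‖ₑ ^ 2
      = ENNReal.ofReal (2 * Real.pi) * ∫⁻ ξ, ‖h ξ‖ₑ ^ 2 * ‖profile γ r c j ξ α‖ₑ ^ 2 ∂freq := by
  set F : ℝ → ℂ := (Ioi (0 : ℝ)).indicator fun ξ => h ξ * (profile γ r c j ξ α : ℂ) with hF
  have h1 : Integrable F := by
    rw [hF, integrable_indicator_iff measurableSet_Ioi]
    exact hh.integrable_mul (memLp_profile hγ hc hj hα).ofReal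
  have h2 : MemLp F 2 := by
    rw [hF, memLp_indicator_iff_restrict measurableSet_Ioi]
    refine MemLp.mul (r := 2) (p := 2) (q := ⊤) (memLp_top_of_bound
      (Complex.measurable_ofReal.comp (measurable_profile_left α)).aestronglyMeasurable
      (α ^ j * ((2 * j + r + 1) / (2 * γ) / (c * α ^ γ)) ^ ((2 * j + r + 1) / (2 * γ))) ?_) hh
    · filter_upwards [ae_restrict_mem measurableSet_Ioi] with ξ hξ
      simp only [Complex.norm_real, Real.norm_eq_abs,
        abs_of_nonneg (profile_nonneg (γ := γ) (r := r) (c := c) (j := j) hξ hα)]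
      exact profile_le hγ hc hj hα hξ
  have key := lintegral_enorm_integral_mul_exp_sq h1 h2
  have e1 (s : ℝ) : ∫ ξ, F ξ * Complex.exp (ξ * s * Complex.I) = superpose γ r c j h (s, α) := by
    rw [superpose, ← integral_indicator measurableSet_Ioi]
    refine integral_congr_ae (Filter.Eventually.of_forall fun ξ => ?_)
    by_cases hξ : ξ ∈ Ioi (0 : ℝ) <;> simp [hF, hξ]
  have e2 : ∫⁻ ξ, ‖F ξ‖ₑ ^ 2 = ∫⁻ ξ, ‖h ξ‖ₑ ^ 2 * ‖profile γ r c j ξ α‖ₑ ^ 2 ∂freq := by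
    rw [← lintegral_indicator measurableSet_Ioi]
    refine lintegral_congr fun ξ => ?_
    by_cases hξ : ξ ∈ Ioi (0 : ℝ)
    · simp only [hF, indicator_of_mem hξ, enorm_mul, mul_pow]
      congr 2
      simp [enorm_eq_nnnorm]
    · simp [hF, hξ]
  simp_rw [e1, e2] at key
  exact key

/-- The function `ω^k ∫ h(ξ) α^j ξ^a e^{-c ξ α^γ} e^{iξs} dξ` on `M_γ`. -/
def waveFun (γ r c j : ℝ) (k : ℕ) (h : ℝ → ℂ) (ζ : ℂ × ℂ) : ℂ :=
  superpose γ r c j h (ζ.2.re, ‖ζ.1‖) * (ζ.1 / (‖ζ.1‖ : ℂ)) ^ k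

theorem measurable_waveFun (k : ℕ) {h : ℝ → ℂ} (hh : Measurable h) :
    Measurable (waveFun γ r c j k h) := by
  unfold waveFun
  exact ((measurable_superpose hh).comp (by fun_prop)).mul (by fun_prop)

theorem norm_unit_pow {ζ : ℂ × ℂ} (hζ : 0 < ‖ζ.1‖) (k : ℕ) : ‖(ζ.1 / (‖ζ.1‖ : ℂ)) ^ k‖ = 1 := by
  rw [norm_pow, norm_div, Complex.norm_real, norm_norm, div_self hζ.ne', one_pow]

theorem enorm_unit_pow {ζ : ℂ × ℂ} (hζ : 0 < ‖ζ.1‖) (k : ℕ) :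
    ‖(ζ.1 / (‖ζ.1‖ : ℂ)) ^ k‖ₑ = 1 := by
  rw [← ofReal_norm, norm_unit_pow hζ, ENNReal.ofReal_one]

/-- The isometry property of the wave superposition, up to a constant. -/
theorem lintegral_waveFun_sq (hγ : 0 < γ) (hc : 0 < c) (hj : 0 < 2 * j + r + 1) (k : ℕ)
    {h : ℝ → ℂ} (hhm : Measurable h) (hh : MemLp h 2 freq) :
    ∫⁻ ζ, ‖waveFun γ r c j k h ζ‖ₑ ^ 2 ∂mu γ r
      = ENNReal.ofReal ((2 * Real.pi) ^ 2 * profileNormSq γ r c j) * ∫⁻ ξ, ‖h ξ‖ₑ ^ 2 ∂freq := by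
  have hG : Measurable fun q => ‖superpose γ r c j h q‖ₑ ^ 2 :=
    (measurable_superpose hhm).enorm.pow_const 2
  have e0 : ∫⁻ ζ, ‖waveFun γ r c j k h ζ‖ₑ ^ 2 ∂mu γ r
      = ∫⁻ ζ, ‖superpose γ r c j h (ζ.2.re, ‖ζ.1‖)‖ₑ ^ 2 ∂mu γ r := by
    refine lintegral_congr_ae ?_
    filter_upwards [ae_mu_norm_pos γ r] with ζ hζ
    rw [waveFun, enorm_mul, enorm_unit_pow hζ, mul_one]
  have hpm : Measurable fun p : ℝ × ℝ => ‖profile γ r c j p.2 p.1‖ₑ ^ 2 :=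
    ((measurable_profile.comp measurable_swap).enorm).pow_const 2
  have e1 : ∀ α ∈ Ioi (0 : ℝ),
      ENNReal.ofReal (α ^ r) * ∫⁻ s, ‖superpose γ r c j h (s, α)‖ₑ ^ 2
      = ENNReal.ofReal (2 * Real.pi) * ∫⁻ ξ, ‖h ξ‖ₑ ^ 2 *
          (ENNReal.ofReal (α ^ r) * ‖profile γ r c j ξ α‖ₑ ^ 2) ∂freq := by
    intro α hα
    rw [lintegral_superpose_sq hγ hc hj hh hα, mul_left_comm]
    congr 1
    have hm1 : Measurable fun ξ => ‖h ξ‖ₑ ^ 2 * ‖profile γ r c j ξ α‖ₑ ^ 2 :=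
      (hhm.enorm.pow_const 2).mul ((measurable_profile_left α).enorm.pow_const 2)
    rw [← lintegral_const_mul _ hm1]
    exact lintegral_congr fun ξ => by ring
  have hmeas : Measurable fun p : ℝ × ℝ => ‖h p.2‖ₑ ^ 2 *
      (ENNReal.ofReal (p.1 ^ r) * ‖profile γ r c j p.2 p.1‖ₑ ^ 2) :=
    ((hhm.comp measurable_snd).enorm.pow_const 2).mul (Measurable.mul (by fun_prop) hpm)
  -- After exchanging the integrals, the inner α-integral is the same constant for every ξ.
  have e2 : ∫⁻ α in Ioi 0, ∫⁻ ξ, ‖h ξ‖ₑ ^ 2 *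
        (ENNReal.ofReal (α ^ r) * ‖profile γ r c j ξ α‖ₑ ^ 2) ∂freq
      = ENNReal.ofReal (profileNormSq γ r c j) * ∫⁻ ξ, ‖h ξ‖ₑ ^ 2 ∂freq := by
    have hswap := lintegral_lintegral_swap (μ := volume.restrict (Ioi (0 : ℝ))) (ν := freq)
      (f := fun α ξ => ‖h ξ‖ₑ ^ 2 * (ENNReal.ofReal (α ^ r) * ‖profile γ r c j ξ α‖ₑ ^ 2))
      hmeas.aemeasurable
    rw [hswap, ← lintegral_const_mul _ (hhm.enorm.pow_const 2)]
    refine setLIntegral_congr_fun measurableSet_Ioi fun ξ hξ => ?_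
    have hm : Measurable fun α => ENNReal.ofReal (α ^ r) * ‖profile γ r c j ξ α‖ₑ ^ 2 :=
      Measurable.mul (by fun_prop) ((measurable_profile_right ξ).enorm.pow_const 2)
    rw [lintegral_const_mul _ hm, lintegral_profile_sq hγ hc hj hξ, mul_comm]
  have hm2 : Measurable fun α => ∫⁻ ξ, ‖h ξ‖ₑ ^ 2 *
      (ENNReal.ofReal (α ^ r) * ‖profile γ r c j ξ α‖ₑ ^ 2) ∂freq := hmeas.lintegral_prod_right'
  rw [e0, lintegral_mu_radial hG, lintegral_weighted hG,
    setLIntegral_congr_fun measurableSet_Ioi e1, lintegral_const_mul _ hm2, e2, ← mul_assoc,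
    ← mul_assoc, ← ENNReal.ofReal_mul Real.two_pi_pos.le, ← sq,
    ← ENNReal.ofReal_mul (by positivity)]

end

/-! ### Wave operators and point evaluations. -/

section

variable {γ r c j : ℝ}

theorem memLp_waveFun (hγ : 0 < γ) (hc : 0 < c) (hj : 0 < 2 * j + r + 1) (k : ℕ)
    (h : Lp ℂ 2 freq) : MemLp (waveFun γ r c j k h) 2 (mu γ r) := by
  have hm := (Lp.stronglyMeasurable h).measurable
  refine ⟨(measurable_waveFun k hm).aestronglyMeasurable, ?_⟩
  have e := eLpNorm_nnreal_pow_eq_lintegral (f := waveFun γ r c j k h) (μ := mu γ r) (p := 2)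
    two_ne_zero
  have e2 := lintegral_waveFun_sq hγ hc hj k hm (Lp.memLp h)
  rw [← enorm_sq_eq_lintegral] at e2
  have e3 : eLpNorm (waveFun γ r c j k h) 2 (mu γ r) ^ 2 < ⊤ := by
    have : eLpNorm (waveFun γ r c j k h) 2 (mu γ r) ^ 2
        = ∫⁻ ζ, ‖waveFun γ r c j k h ζ‖ₑ ^ 2 ∂mu γ r := by simpa using e
    rw [this, e2]
    exact ENNReal.mul_lt_top ENNReal.ofReal_lt_top (ENNReal.pow_lt_top enorm_lt_top)
  simpa using e3

theorem waveFun_add (hγ : 0 < γ) (hc : 0 < c) (hj : 0 < 2 * j + r + 1) (k : ℕ)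
    (h₁ h₂ : Lp ℂ 2 freq) {ζ : ℂ × ℂ} (hζ : 0 < ‖ζ.1‖) :
    waveFun γ r c j k (h₁ + h₂ : Lp ℂ 2 freq) ζ
      = waveFun γ r c j k h₁ ζ + waveFun γ r c j k h₂ ζ := by
  rw [waveFun, waveFun, waveFun, ← add_mul, superpose, superpose, superpose, ← integral_add
    (integrable_superpose hγ hc hj (Lp.memLp h₁) hζ _)
    (integrable_superpose hγ hc hj (Lp.memLp h₂) hζ _)]
  congr 1
  refine integral_congr_ae ?_
  filter_upwards [Lp.coeFn_add h₁ h₂] with ξ hξ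
  rw [hξ, Pi.add_apply]
  ring

theorem waveFun_smul (k : ℕ) (a : ℂ) (h : Lp ℂ 2 freq) (ζ : ℂ × ℂ) :
    waveFun γ r c j k (a • h : Lp ℂ 2 freq) ζ = a * waveFun γ r c j k h ζ := by
  rw [waveFun, waveFun, ← mul_assoc, superpose, superpose, ← integral_const_mul]
  congr 1
  refine integral_congr_ae ?_
  filter_upwards [Lp.coeFn_smul a h] with ξ hξ
  rw [hξ, Pi.smul_apply, smul_eq_mul]
  ring

/-- The constant by which `wave` scales norms. -/
def waveNorm (γ r c j : ℝ) : ℝ :=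
  2 * Real.pi * √(profileNormSq γ r c j)

theorem profileNormSq_pos (hγ : 0 < γ) (hc : 0 < c) (hj : 0 < 2 * j + r + 1) :
    0 < profileNormSq γ r c j := by
  have := Real.Gamma_pos_of_pos (show 0 < (2 * j + r + 1) / γ by positivity)
  unfold profileNormSq; positivity

theorem waveNorm_pos (hγ : 0 < γ) (hc : 0 < c) (hj : 0 < 2 * j + r + 1) :
    0 < waveNorm γ r c j :=
  mul_pos Real.two_pi_pos (Real.sqrt_pos.2 (profileNormSq_pos hγ hc hj))

theorem norm_toLp_waveFun (hγ : 0 < γ) (hc : 0 < c) (hj : 0 < 2 * j + r + 1) (k : ℕ)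
    (h : Lp ℂ 2 freq) :
    ‖(memLp_waveFun hγ hc hj k h).toLp‖ = waveNorm γ r c j * ‖h‖ := by
  have e : ‖(memLp_waveFun hγ hc hj k h).toLp‖ₑ ^ 2
      = ENNReal.ofReal ((2 * Real.pi) ^ 2 * profileNormSq γ r c j) * ‖h‖ₑ ^ 2 := by
    rw [enorm_sq_eq_lintegral, enorm_sq_eq_lintegral, ← lintegral_waveFun_sq hγ hc hj k
      (Lp.stronglyMeasurable h).measurable (Lp.memLp h)]
    refine lintegral_congr_ae ?_
    filter_upwards [(memLp_waveFun hγ hc hj k h).coeFn_toLp] with ζ hζ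
    rw [hζ]
  have hN := profileNormSq_pos hγ hc hj
  rw [← ofReal_norm, ← ofReal_norm, ← ENNReal.ofReal_pow (norm_nonneg _),
    ← ENNReal.ofReal_pow (norm_nonneg _), ← ENNReal.ofReal_mul (by positivity),
    ENNReal.ofReal_eq_ofReal_iff (by positivity) (by positivity)] at e
  refine (pow_left_inj₀ (norm_nonneg _)
    (mul_nonneg (waveNorm_pos hγ hc hj).le (norm_nonneg _)) two_ne_zero).1 ?_
  rw [e, waveNorm, mul_pow _ ‖h‖, mul_pow _ (√_), Real.sq_sqrt hN.le]

/-- The superposition of waves, as a bounded operator `L²(0, ∞) → L²(M_γ, μ_r)`. -/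
def wave (hγ : 0 < γ) (hc : 0 < c) (hj : 0 < 2 * j + r + 1) (k : ℕ) :
    Lp ℂ 2 freq →L[ℂ] L2 γ r :=
  LinearMap.mkContinuous
    { toFun := fun h => (memLp_waveFun hγ hc hj k h).toLp
      map_add' := fun h₁ h₂ => by
        refine Lp.ext ?_
        filter_upwards [(memLp_waveFun hγ hc hj k (h₁ + h₂)).coeFn_toLp,
          (memLp_waveFun hγ hc hj k h₁).coeFn_toLp, (memLp_waveFun hγ hc hj k h₂).coeFn_toLp,
          Lp.coeFn_add (memLp_waveFun hγ hc hj k h₁).toLp (memLp_waveFun hγ hc hj k h₂).toLp,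
          ae_mu_norm_pos γ r] with ζ e e₁ e₂ e₃ hζ
        rw [e, e₃, Pi.add_apply, e₁, e₂, waveFun_add hγ hc hj k h₁ h₂ hζ]
      map_smul' := fun a h => by
        refine Lp.ext ?_
        filter_upwards [(memLp_waveFun hγ hc hj k (a • h)).coeFn_toLp,
          (memLp_waveFun hγ hc hj k h).coeFn_toLp,
          Lp.coeFn_smul a (memLp_waveFun hγ hc hj k h).toLp] with ζ e e₁ e₂
        rw [e, RingHom.id_apply, e₂, Pi.smul_apply, e₁, waveFun_smul, smul_eq_mul] }
    (waveNorm γ r c j) fun h => (norm_toLp_waveFun hγ hc hj k h).le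

theorem coeFn_wave (hγ : 0 < γ) (hc : 0 < c) (hj : 0 < 2 * j + r + 1) (k : ℕ)
    (h : Lp ℂ 2 freq) : wave hγ hc hj k h =ᵐ[mu γ r] waveFun γ r c j k h :=
  (memLp_waveFun hγ hc hj k h).coeFn_toLp

theorem norm_wave (hγ : 0 < γ) (hc : 0 < c) (hj : 0 < 2 * j + r + 1) (k : ℕ)
    (h : Lp ℂ 2 freq) : ‖wave hγ hc hj k h‖ = waveNorm γ r c j * ‖h‖ :=
  norm_toLp_waveFun hγ hc hj k h

theorem wave_mem_L2k (hγ : 0 < γ) (hc : 0 < c) (hj : 0 < 2 * j + r + 1) (k : ℕ)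
    (h : Lp ℂ 2 freq) : wave hγ hc hj k h ∈ L2k γ r k :=
  ⟨superpose γ r c j h, measurable_superpose (Lp.stronglyMeasurable h).measurable,
    coeFn_wave hγ hc hj k h⟩

/-- The function representing the evaluation of waves at `z`. -/
def evalFun (γ r c j : ℝ) (k : ℕ) (z : ℂ × ℂ) (ξ : ℝ) : ℂ :=
  starRingEnd ℂ ((profile γ r c j ξ ‖z.1‖ : ℂ) * Complex.exp (ξ * z.2.re * Complex.I)
    * (z.1 / (‖z.1‖ : ℂ)) ^ k)

theorem memLp_evalFun (hγ : 0 < γ) (hc : 0 < c) (hj : 0 < 2 * j + r + 1) (k : ℕ) {z : ℂ × ℂ}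
    (hz : 0 < ‖z.1‖) : MemLp (evalFun γ r c j k z) 2 freq := by
  have h1 := (memLp_profile (γ := γ) (r := r) hγ hc hj hz).ofReal (K := ℂ)
  refine MemLp.of_le h1 ?_ ?_
  · unfold evalFun
    have h2 : Measurable fun ξ => (profile γ r c j ξ ‖z.1‖ : ℂ) :=
      Complex.measurable_ofReal.comp (measurable_profile_left _)
    exact (Complex.continuous_conj.measurable.comp ((h2.mul (by fun_prop)).mul
      measurable_const)).aestronglyMeasurable
  · refine Filter.Eventually.of_forall fun ξ => ?_
    rw [evalFun, RCLike.norm_conj, norm_mul, norm_mul, norm_unit_pow hz, norm_cexp_mul_I, mul_one,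
      mul_one]
    rfl

/-- Evaluation of a wave at z is a bounded functional of its frequency density; this is what makes
the first factor V appear in the factorization. -/
theorem inner_evalFun (hγ : 0 < γ) (hc : 0 < c) (hj : 0 < 2 * j + r + 1) (k : ℕ) {z : ℂ × ℂ}
    (hz : 0 < ‖z.1‖) (h : Lp ℂ 2 freq) :
    inner ℂ ((memLp_evalFun hγ hc hj k hz).toLp (evalFun γ r c j k z)) h
      = waveFun γ r c j k h z := by
  rw [L2.inner_def, waveFun, superpose, ← integral_mul_const]
  refine integral_congr_ae ?_
  filter_upwards [(memLp_evalFun hγ hc hj k hz).coeFn_toLp] with ξ hξ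
  rw [hξ, RCLike.inner_apply, evalFun, Complex.conj_conj]
  ring

/-! ### The phase and the factorization of its powers. -/

/-- The quantity `(γ-1)α^γ + β^γ + i(s-t)` for `q = (s, α)` and `p = (t, β)`. -/
def phase (γ : ℝ) (q p : ℝ × ℝ) : ℂ :=
  (((γ - 1) * q.2 ^ γ + p.2 ^ γ : ℝ) : ℂ) + ((q.1 - p.1 : ℝ) : ℂ) * Complex.I

theorem phase_re (q p : ℝ × ℝ) : (phase γ q p).re = (γ - 1) * q.2 ^ γ + p.2 ^ γ := by
  simp only [phase, Complex.add_re, Complex.ofReal_re, Complex.re_ofReal_mul, Complex.I_re,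
    mul_zero, add_zero]

theorem phase_re_pos (hγ : 1 < γ) {q p : ℝ × ℝ} (hq : 0 < q.2) (hp : 0 < p.2) :
    0 < (phase γ q p).re := by
  have : 0 < γ - 1 := by linarith
  rw [phase_re]; positivity

/-- The exponent of `α` in the reduced kernel, divided by the weight. -/
def dualExponent (γ r : ℝ) (k : ℕ) : ℝ := (γ - 1) * (k + 1) - r

/-- The two profiles at ξ multiply to ξ^{k+1} times the modulus of an exponential in the phase, and
the Laplace transform of ξ^{k+1} gives the power k + 2. Hence applying U to the evaluation vector at
z recovers the reduced kernel, up to conjugation, weight and constants. -/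
theorem superpose_evalFun (hγ : 1 < γ) (k : ℕ) {z : ℂ × ℂ} (hz : 0 < ‖z.1‖) {q : ℝ × ℝ}
    (hq : 0 < q.2) :
    superpose γ r (γ - 1) (dualExponent γ r k) (evalFun γ r 1 k k z) q
      = starRingEnd ℂ ((z.1 / (‖z.1‖ : ℂ)) ^ k *
          ((‖z.1‖ ^ k * q.2 ^ dualExponent γ r k : ℝ) * (k + 1).factorial
            / phase γ q (z.2.re, ‖z.1‖) ^ (k + 2))) := by
  set β := ‖z.1‖ with hβ
  set p : ℝ × ℝ := (z.2.re, β) with hp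
  have hγ0 : 0 < γ := by linarith
  have hA : 0 < (starRingEnd ℂ (phase γ q p)).re := by
    rw [Complex.conj_re]; exact phase_re_pos hγ hq hz
  have key : ∀ ξ ∈ Ioi (0 : ℝ), evalFun γ r 1 k k z ξ *
      (profile γ r (γ - 1) (dualExponent γ r k) ξ q.2 : ℂ) * Complex.exp (ξ * q.1 * Complex.I)
      = starRingEnd ℂ ((z.1 / (β : ℂ)) ^ k) * ((β ^ k * q.2 ^ dualExponent γ r k : ℝ) : ℂ)
        * ((ξ : ℂ) ^ (k + 1) * Complex.exp (-(starRingEnd ℂ (phase γ q p) * ξ))) := by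
    intro ξ hξ
    have hξ : 0 < ξ := hξ
    have e1 : profile γ r 1 k ξ β * profile γ r (γ - 1) (dualExponent γ r k) ξ q.2
        = β ^ k * q.2 ^ dualExponent γ r k * (ξ ^ (k + 1) *
          Real.exp (-(ξ * ((γ - 1) * q.2 ^ γ + β ^ γ)))) := by
      unfold profile
      rw [Real.rpow_natCast]
      -- With this dual exponent the two half-powers add up to k + 1, and r drops out.
      have e2 : ξ ^ (k + 1) = ξ ^ ((2 * (k : ℝ) + r + 1) / (2 * γ)) *
          ξ ^ ((2 * dualExponent γ r k + r + 1) / (2 * γ)) := by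
        rw [← Real.rpow_add hξ, ← Real.rpow_natCast]
        congr 1
        unfold dualExponent
        push_cast
        field_simp
        ring
      have e3 : Real.exp (-(ξ * ((γ - 1) * q.2 ^ γ + β ^ γ))) = Real.exp (-(1 * ξ * β ^ γ)) *
          Real.exp (-((γ - 1) * ξ * q.2 ^ γ)) := by
        rw [← Real.exp_add]; congr 1; ring
      rw [e2, e3]; ring
    have e4 : Complex.exp (-(starRingEnd ℂ (phase γ q p) * ξ))
        = (Real.exp (-(ξ * ((γ - 1) * q.2 ^ γ + β ^ γ))) : ℂ) *
          (starRingEnd ℂ (Complex.exp (ξ * z.2.re * Complex.I))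
            * Complex.exp (ξ * q.1 * Complex.I)) := by
      rw [← Complex.exp_conj, ← Complex.exp_add, Complex.ofReal_exp, ← Complex.exp_add]
      congr 1
      simp only [phase, hp, map_add, map_mul, Complex.conj_ofReal, Complex.conj_I]
      push_cast
      ring
    rw [e4, evalFun, map_mul, map_mul, Complex.conj_ofReal]
    have e5 := congrArg (fun x : ℝ => (x : ℂ)) e1
    simp only [Complex.ofReal_mul, Complex.ofReal_pow] at e5 ⊢
    linear_combination (starRingEnd ℂ (Complex.exp (ξ * z.2.re * Complex.I)) *
      starRingEnd ℂ ((z.1 / (β : ℂ)) ^ k) * Complex.exp (ξ * q.1 * Complex.I)) * e5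
  rw [superpose, setIntegral_congr_fun measurableSet_Ioi key, integral_const_mul,
    integral_pow_mul_cexp _ hA]
  simp only [map_mul, map_div₀, map_pow, Complex.conj_ofReal, map_natCast]
  ring

end

/-! ### Reduction of the Leray integral to the half-plane. -/

section

variable {γ r c j : ℝ}

/-- Strict weighted arithmetic-geometric mean inequality. -/
theorem mul_rpow_mul_lt (hγ : 1 < γ) {α β : ℝ} (hα : 0 < α) (hβ : 0 < β) (h : α ≠ β) :
    γ * α ^ (γ - 1) * β < (γ - 1) * α ^ γ + β ^ γ := by
  -- Strict Bernoulli inequality for (β/α)^γ, to be multiplied by α^γ.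
  have hb := one_add_mul_self_lt_rpow_one_add (s := β / α - 1) (by
    have : 0 < β / α := by positivity
    linarith) (by
    intro h0
    have : β / α = 1 := by linarith
    exact h ((div_eq_one_iff_eq hα.ne').1 this).symm) hγ
  rw [add_sub_cancel, Real.div_rpow hβ.le hα.le] at hb
  have hpos : 0 < α ^ γ := by positivity
  have := mul_lt_mul_of_pos_right hb hpos
  rw [div_mul_cancel₀ _ hpos.ne'] at this
  have e : α ^ γ = α ^ (γ - 1) * α := by
    rw [← Real.rpow_add_one hα.ne']; congr 1; ring
  have e2 : (1 + γ * (β / α - 1)) * α ^ γ = γ * α ^ (γ - 1) * β - (γ - 1) * α ^ γ := by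
    rw [e]; field_simp; ring
  linarith

/-- On the hypersurface Im z₂ = |z₁|^γ, and i · iα^γ = -α^γ lowers γα^γ to (γ-1)α^γ; the only
θ-dependence left is e^{-iθ}. -/
theorem kernel_param {z : ℂ × ℂ} (hz : z ∈ hypersurface γ) {q : ℝ × ℝ} (hq : 0 < q.2) (θ : ℝ) :
    kernel γ z (param γ (q.1, q.2, θ))
      = 4 / (phase γ q (z.2.re, ‖z.1‖) - ((γ * q.2 ^ (γ - 1) : ℝ) * z.1)
          * Complex.exp (-(θ * Complex.I))) ^ 2 := by
  rw [kernel, norm_param_fst hq]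
  congr 2
  have hz2 : z.2 = (z.2.re : ℂ) + ((‖z.1‖ ^ γ : ℝ) : ℂ) * Complex.I := by
    have : z.2.im = ‖z.1‖ ^ γ := hz
    rw [← this, Complex.re_add_im]
  rw [hz2]
  simp only [param, phase, map_mul, Complex.conj_ofReal, ← Complex.exp_conj, Complex.conj_I,
    Complex.add_re, Complex.ofReal_re, Complex.re_ofReal_mul, Complex.I_re, mul_zero, add_zero]
  have e1 : (q.2 : ℂ) * ((q.2 ^ (γ - 2) : ℝ) : ℂ) = ((q.2 ^ (γ - 1) : ℝ) : ℂ) := by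
    rw [← Complex.ofReal_mul, mul_comm, ← Real.rpow_add_one hq.ne']; congr 2; ring
  have e2 : ((q.2 ^ (γ - 1) : ℝ) : ℂ) * (q.2 : ℂ) = ((q.2 ^ γ : ℝ) : ℂ) := by
    rw [← Complex.ofReal_mul, ← Real.rpow_add_one hq.ne']; congr 2; ring
  have e3 : Complex.exp (θ * -Complex.I) * Complex.exp (θ * Complex.I) = 1 := by
    rw [← Complex.exp_add]; simp
  rw [← mul_neg]
  set E := Complex.exp (θ * -Complex.I)
  set E' := Complex.exp (θ * Complex.I)
  push_cast at e1 e2 ⊢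
  linear_combination (γ * E * (q.2 * E' - z.1)) * e1 + γ * E * E' * e2 +
    (γ * ((q.2 ^ γ : ℝ) : ℂ)) * e3 + (((q.2 ^ γ : ℝ) : ℂ) - ((‖z.1‖ ^ γ : ℝ) : ℂ)) * Complex.I_sq

/-- The normalizing constant of the reduced kernel. -/
def reducedConst (γ : ℝ) (k : ℕ) : ℝ := γ ^ (k + 2) / (2 * Real.pi * k.factorial)

/-- The kernel of the sub-Leray operator on functions of `(s, α)`. -/
def reducedKernel (γ : ℝ) (k : ℕ) (q p : ℝ × ℝ) : ℂ :=
  (reducedConst γ k * (k + 1).factorial * p.2 ^ k * q.2 ^ ((γ - 1) * (k + 1)) : ℝ)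
    / phase γ q p ^ (k + 2)

theorem ae_halfPlane_ne (β : ℝ) : ∀ᵐ q ∂halfPlane, q.2 ≠ β := by
  rw [halfPlane_eq_prod]
  refine Measure.quasiMeasurePreserving_snd.ae (p := fun x => x ≠ β) ?_
  exact compl_mem_ae_iff.2 (measure_singleton β)

/-- Off the null set α = |z₁| the strict inequality makes the geometric series converge, so the
θ-integral is an explicit Fourier coefficient. -/
theorem circleIntegrand_eq (hγ : 1 < γ) (k : ℕ) {z : ℂ × ℂ} (hz : z ∈ hypersurface γ)
    (hz0 : 0 < ‖z.1‖) {f : ℂ × ℂ → ℂ} {g : ℝ × ℝ → ℂ}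
    (hf : ∀ᵐ ζ ∂mu γ r, f ζ = g (ζ.2.re, ‖ζ.1‖) * (ζ.1 / (‖ζ.1‖ : ℂ)) ^ k) :
    ∀ᵐ q ∂halfPlane, circleIntegrand γ f z q
      = (z.1 / (‖z.1‖ : ℂ)) ^ k * reducedKernel γ k q (z.2.re, ‖z.1‖) * g q := by
  filter_upwards [ae_ae_of_ae_mu hf, ae_halfPlane_pos, ae_halfPlane_ne ‖z.1‖] with q hq hpos hne
  have hγ0 : 0 < γ := by linarith
  set A := phase γ q (z.2.re, ‖z.1‖) with hA
  set u : ℂ := (γ * q.2 ^ (γ - 1) : ℝ) * z.1 with hu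
  have hlt : ‖u‖ < ‖A‖ := by
    refine lt_of_lt_of_le ?_ (Complex.re_le_norm A)
    rw [hu, norm_mul, Complex.norm_real, Real.norm_eq_abs, abs_of_nonneg (by positivity), hA,
      phase_re]
    exact mul_rpow_mul_lt hγ hpos hz0 hne
  have hA0 : A ≠ 0 := norm_pos_iff.1 ((norm_nonneg u).trans_lt hlt)
  have e : ∫ θ in Ico 0 (2 * Real.pi),
      f (param γ (q.1, q.2, θ)) * kernel γ z (param γ (q.1, q.2, θ))
      = ∫ θ in Ico 0 (2 * Real.pi), g q * (Complex.exp (θ * Complex.I) ^ k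
        * (4 / (A - u * Complex.exp (-(θ * Complex.I))) ^ 2)) := by
    refine integral_congr_ae ?_
    filter_upwards [show ∀ᵐ θ ∂volume.restrict (Ico 0 (2 * Real.pi)), _ from hq] with θ hθ
    rw [hθ, kernel_param hz hpos, param_fst_div_norm hpos, param_snd_re, norm_param_fst hpos,
      mul_assoc]
  rw [circleIntegrand, e, integral_const_mul, integral_Ico_exp_mul_inv_sq k hlt, reducedKernel,
    ← hA, leviDensity, reducedConst, hu, mul_pow, div_pow]
  have hn : (‖z.1‖ : ℂ) ≠ 0 := by exact_mod_cast hz0.ne'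
  have hpi : (Real.pi : ℂ) ≠ 0 := by exact_mod_cast Real.pi_ne_zero
  have hfac : (k.factorial : ℂ) ≠ 0 := by exact_mod_cast k.factorial_ne_zero
  have hpow : q.2 ^ ((γ - 1) * (k + 1)) = (q.2 ^ (γ - 1)) ^ k * q.2 ^ (γ - 1) := by
    rw [Real.rpow_mul hpos.le, ← pow_succ, ← Real.rpow_natCast _ (k + 1)]
    push_cast; rfl
  rw [hpow, Nat.factorial_succ]
  push_cast
  field_simp
  ring

theorem measure_halfPlane : volume.restrict (univ ×ˢ Ioi (0 : ℝ)) = halfPlane := rfl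

theorem transform_eq (hγ : 1 < γ) (k : ℕ) {z : ℂ × ℂ} (hz : z ∈ hypersurface γ)
    (hz0 : 0 < ‖z.1‖) {f : ℂ × ℂ → ℂ} {g : ℝ × ℝ → ℂ}
    (hf : ∀ᵐ ζ ∂mu γ r, f ζ = g (ζ.2.re, ‖ζ.1‖) * (ζ.1 / (‖ζ.1‖ : ℂ)) ^ k) :
    transform γ f z = (z.1 / (‖z.1‖ : ℂ)) ^ k *
      ∫ q, reducedKernel γ k q (z.2.re, ‖z.1‖) * g q ∂halfPlane := by
  rw [transform, measure_halfPlane, integral_congr_ae (circleIntegrand_eq hγ k hz hz0 hf),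
    ← integral_const_mul]
  simp only [mul_assoc]

/-- The Leray integral of `f ∈ L²_k` at `z` converges, and it is the pairing of `f` with a wave. -/
theorem integrable_and_transform_eq_inner (hγ : 1 < γ) (k : ℕ) (hk : 0 < 2 * (k : ℝ) + r + 1)
    (hd : 0 < 2 * dualExponent γ r k + r + 1)
    {z : ℂ × ℂ} (hz : z ∈ hypersurface γ) (hz0 : 0 < ‖z.1‖) {f : L2 γ r} (hf : f ∈ L2k γ r k) :
    Integrable (circleIntegrand γ f z) halfPlane ∧
    transform γ f z = (reducedConst γ k / (2 * Real.pi) : ℝ) *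
      inner ℂ (wave (zero_lt_one.trans hγ) (sub_pos.2 hγ) hd k
        ((memLp_evalFun (zero_lt_one.trans hγ) one_pos hk k hz0).toLp (evalFun γ r 1 k k z))) f := by
  obtain ⟨g, -, hg⟩ := hf
  set e := (memLp_evalFun (zero_lt_one.trans hγ) one_pos hk k hz0).toLp (evalFun γ r 1 k k z)
    with he
  set w := wave (zero_lt_one.trans hγ) (sub_pos.2 hγ) hd k e with hw
  have hF : Integrable (fun ζ => inner ℂ (w ζ) (f ζ)) (mu γ r) := L2.integrable_inner w f
  obtain ⟨h1, h2⟩ := integrable_integral_mu hF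
  have hsup (q : ℝ × ℝ) : superpose γ r (γ - 1) (dualExponent γ r k) e q
      = superpose γ r (γ - 1) (dualExponent γ r k) (evalFun γ r 1 k k z) q := by
    refine integral_congr_ae ?_
    filter_upwards [(memLp_evalFun (zero_lt_one.trans hγ) one_pos hk k hz0).coeFn_toLp] with ξ hξ
    rw [he, hξ]
  have hae : ∀ᵐ q ∂halfPlane, circleIntegrand γ f z q
      = (reducedConst γ k / (2 * Real.pi) : ℝ) *
        ((q.2 ^ r : ℝ) • ∫ θ, inner ℂ (w (param γ (q.1, q.2, θ))) (f (param γ (q.1, q.2, θ)))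
          ∂angle) := by
    filter_upwards [circleIntegrand_eq hγ k hz hz0 hg, ae_halfPlane_pos, ae_ae_of_ae_mu hg,
      ae_ae_of_ae_mu (coeFn_wave (zero_lt_one.trans hγ) (sub_pos.2 hγ) hd k e)]
      with q hq hpos hgq hwq
    set S := superpose γ r (γ - 1) (dualExponent γ r k) (evalFun γ r 1 k k z) q with hS
    -- The factors e^{ikθ} cancel in the pairing, so the integrand is constant in θ; the resulting
    -- 2π is the one divided out of the constant.
    have e1 : ∫ θ, inner ℂ (w (param γ (q.1, q.2, θ))) (f (param γ (q.1, q.2, θ))) ∂angle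
        = ∫ θ, g q * starRingEnd ℂ S ∂angle := by
      refine integral_congr_ae ?_
      filter_upwards [hgq, hwq] with θ h1 h2
      have h3 : Complex.exp (θ * Complex.I) * starRingEnd ℂ (Complex.exp (θ * Complex.I)) = 1 := by
        rw [Complex.mul_conj, Complex.normSq_eq_norm_sq, Complex.norm_exp_ofReal_mul_I]; simp
      rw [h1, hw, h2, waveFun, RCLike.inner_apply, param_fst_div_norm hpos, param_snd_re,
        norm_param_fst hpos, hsup, ← hS, map_mul, map_pow, mul_mul_mul_comm, ← mul_pow, h3,
        one_pow, mul_one]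
    rw [hq, e1, integral_const, hS, superpose_evalFun hγ k hz0 hpos, Complex.conj_conj,
      measureReal_def, angle_univ, ENNReal.toReal_ofReal Real.two_pi_pos.le, reducedKernel]
    have hA0 : phase γ q (z.2.re, ‖z.1‖) ≠ 0 := fun h => by
      have := phase_re_pos hγ hpos (p := (z.2.re, ‖z.1‖)) hz0
      rw [h] at this; simp at this
    have hpow : q.2 ^ ((γ - 1) * (k + 1)) = q.2 ^ r * q.2 ^ dualExponent γ r k := by
      rw [← Real.rpow_add hpos, dualExponent]; congr 1; ring
    have hpi : (Real.pi : ℂ) ≠ 0 := by exact_mod_cast Real.pi_ne_zero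
    rw [hpow]
    simp only [Complex.real_smul]
    push_cast
    field_simp
  refine ⟨(h1.const_mul _).congr (hae.mono fun q hq => hq.symm), ?_⟩
  rw [transform, measure_halfPlane, integral_congr_ae hae, integral_const_mul, h2, L2.inner_def]

end

/-! ### The sub-Leray operator and its exact norm. -/

section

variable {γ r c j : ℝ}

open ContinuousLinearMap in
/-- The sub-Leray operator, as the composition of a wave superposition with the adjoint of
another one. -/
def subLeray (hγ : 1 < γ) (k : ℕ) (hk : 0 < 2 * (k : ℝ) + r + 1)
    (hd : 0 < 2 * dualExponent γ r k + r + 1) : L2k γ r k →L[ℂ] L2k γ r k :=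
  (((reducedConst γ k / (2 * Real.pi) : ℝ) : ℂ) •
    (wave (zero_lt_one.trans hγ) one_pos hk k).codRestrict (L2k γ r k)
      (wave_mem_L2k (zero_lt_one.trans hγ) one_pos hk k)) ∘L
    (adjoint (wave (zero_lt_one.trans hγ) (sub_pos.2 hγ) hd k)) ∘L (L2k γ r k).subtypeL

theorem coe_subLeray (hγ : 1 < γ) (k : ℕ) (hk : 0 < 2 * (k : ℝ) + r + 1)
    (hd : 0 < 2 * dualExponent γ r k + r + 1) (f : L2k γ r k) :
    (subLeray hγ k hk hd f : L2 γ r) = ((reducedConst γ k / (2 * Real.pi) : ℝ) : ℂ) •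
      wave (zero_lt_one.trans hγ) one_pos hk k
        (ContinuousLinearMap.adjoint (wave (zero_lt_one.trans hγ) (sub_pos.2 hγ) hd k) f) :=
  rfl

theorem converges_of_mem (hγ : 1 < γ) (k : ℕ) (hk : 0 < 2 * (k : ℝ) + r + 1)
    (hd : 0 < 2 * dualExponent γ r k + r + 1) (f : L2k γ r k) :
    Converges γ r (f : L2 γ r) := by
  filter_upwards [ae_mem_hypersurface γ r, ae_mu_norm_pos γ r] with z hz hz0
  exact (integrable_and_transform_eq_inner hγ k hk hd hz hz0 f.2).1

/-- With e_z the evaluation vector, the transform at z is c⟨U e_z, f⟩ = c⟨e_z, U*f⟩ = c (V U*f)(z).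
-/
theorem subLeray_ae_eq (hγ : 1 < γ) (k : ℕ) (hk : 0 < 2 * (k : ℝ) + r + 1)
    (hd : 0 < 2 * dualExponent γ r k + r + 1) (f : L2k γ r k) :
    ∀ᵐ z ∂mu γ r, (subLeray hγ k hk hd f : L2 γ r) z = transform γ (f : L2 γ r) z := by
  set h := ContinuousLinearMap.adjoint (wave (zero_lt_one.trans hγ) (sub_pos.2 hγ) hd k) f
    with hh
  rw [coe_subLeray, ← hh]
  filter_upwards [ae_mem_hypersurface γ r, ae_mu_norm_pos γ r,
    coeFn_wave (zero_lt_one.trans hγ) one_pos hk k h,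
    Lp.coeFn_smul ((reducedConst γ k / (2 * Real.pi) : ℝ) : ℂ)
      (wave (zero_lt_one.trans hγ) one_pos hk k h)] with z hz hz0 h1 h2
  rw [h2, Pi.smul_apply, h1, (integrable_and_transform_eq_inner hγ k hk hd hz hz0 f.2).2,
    ← ContinuousLinearMap.adjoint_inner_right, ← hh,
    inner_evalFun (zero_lt_one.trans hγ) one_pos hk k hz0, smul_eq_mul]

theorem reducedConst_pos (hγ : 0 < γ) (k : ℕ) : 0 < reducedConst γ k := by
  have := k.factorial_pos
  unfold reducedConst; positivity

theorem const_mul_waveNorm_sq (hγ : 1 < γ) (k : ℕ) (hk : 0 < 2 * (k : ℝ) + r + 1)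
    (hd : 0 < 2 * dualExponent γ r k + r + 1) :
    (reducedConst γ k / (2 * Real.pi) * waveNorm γ r 1 k
      * waveNorm γ r (γ - 1) (dualExponent γ r k)) ^ 2 = symbol γ r k := by
  have hγ0 : 0 < γ := by linarith
  have hγ1 : 0 < γ - 1 := by linarith
  have hV := profileNormSq_pos hγ0 one_pos hk
  have hU := profileNormSq_pos hγ0 hγ1 hd
  rw [mul_pow, mul_pow, waveNorm, waveNorm, mul_pow _ (√_), mul_pow _ (√_), Real.sq_sqrt hV.le,
    Real.sq_sqrt hU.le]
  have hκ : (2 * dualExponent γ r k + r + 1) / γ = 2 * k + 2 - (2 * k + 1 + r) / γ := by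
    unfold dualExponent; field_simp; ring
  have hκ' : (2 * (k : ℝ) + r + 1) / γ = (2 * k + 1 + r) / γ := by ring
  rw [profileNormSq, profileNormSq, hκ, hκ', symbol, reducedConst, Real.Gamma_nat_eq_factorial]
  set κ := (2 * (k : ℝ) + 1 + r) / γ with hκdef
  rw [Real.mul_rpow zero_le_two hγ1.le, mul_one]
  -- The Gamma arguments of the two profiles sum to 2k + 2, so their powers of 2 combine into the
  -- one in the symbol.
  have h2 : (2 : ℝ) ^ (-κ) * 2 ^ (-(2 * (k : ℝ) + 2 - κ)) = (2 ^ (2 * k + 2))⁻¹ := by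
    rw [← Real.rpow_add two_pos, ← Real.rpow_natCast, ← Real.rpow_neg zero_le_two]
    congr 1; push_cast; ring
  have hf : (k.factorial : ℝ) ≠ 0 := by exact_mod_cast k.factorial_ne_zero
  have hpi := Real.pi_ne_zero
  rw [div_pow γ 2]
  generalize (2 : ℝ) ^ (-κ) = x at *
  generalize (2 : ℝ) ^ (-(2 * (k : ℝ) + 2 - κ)) = y at *
  rw [div_eq_mul_inv (γ ^ (2 * k + 2)), ← h2]
  field_simp
  ring

theorem const_mul_waveNorm_eq (hγ : 1 < γ) (k : ℕ) (hk : 0 < 2 * (k : ℝ) + r + 1)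
    (hd : 0 < 2 * dualExponent γ r k + r + 1) :
    reducedConst γ k / (2 * Real.pi) * waveNorm γ r 1 k
      * waveNorm γ r (γ - 1) (dualExponent γ r k) = √(symbol γ r k) := by
  have h1 := reducedConst_pos (zero_lt_one.trans hγ) k
  have h2 := waveNorm_pos (zero_lt_one.trans hγ) one_pos hk
  have h3 := waveNorm_pos (zero_lt_one.trans hγ) (sub_pos.2 hγ) hd
  rw [← const_mul_waveNorm_sq hγ k hk hd, Real.sqrt_sq (by positivity)]

theorem exists_freq_norm_pos : ∃ h : Lp ℂ 2 freq, 0 < ‖h‖ := by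
  have hv : freq (Ioo 0 1) = 1 := by
    rw [Measure.restrict_apply measurableSet_Ioo, inter_eq_left.2 Ioo_subset_Ioi_self]; simp
  refine ⟨indicatorConstLp 2 (measurableSet_Ioo (a := (0 : ℝ)) (b := 1)) (by simp [hv]) 1, ?_⟩
  rw [norm_indicatorConstLp two_ne_zero ENNReal.ofNat_ne_top, measureReal_def, hv]
  simp

/-- V multiplies norms by a constant, so only ‖U*‖ on L²_k matters. The range of U lies in L²_k, and
U* attains its norm there. -/
theorem norm_subLeray (hγ : 1 < γ) (k : ℕ) (hk : 0 < 2 * (k : ℝ) + r + 1)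
    (hd : 0 < 2 * dualExponent γ r k + r + 1) :
    ‖subLeray hγ k hk hd‖ = √(symbol γ r k) := by
  have hγ0 := zero_lt_one.trans hγ
  set U := wave hγ0 (sub_pos.2 hγ) hd k with hU
  have hc0 : 0 < reducedConst γ k / (2 * Real.pi) :=
    div_pos (reducedConst_pos hγ0 k) Real.two_pi_pos
  have hwV := waveNorm_pos hγ0 one_pos hk
  have hwU := waveNorm_pos hγ0 (sub_pos.2 hγ) hd
  have hnorm (f : L2k γ r k) : ‖subLeray hγ k hk hd f‖ = reducedConst γ k / (2 * Real.pi) *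
      (waveNorm γ r 1 k * ‖ContinuousLinearMap.adjoint U f‖) := by
    change ‖(subLeray hγ k hk hd f : L2 γ r)‖ = _
    rw [coe_subLeray, norm_smul, norm_wave, Complex.norm_real,
      Real.norm_of_nonneg hc0.le]
  rw [← const_mul_waveNorm_eq hγ k hk hd]
  refine le_antisymm (ContinuousLinearMap.opNorm_le_bound _ (by positivity) fun f => ?_) ?_
  · have hU' : ‖ContinuousLinearMap.adjoint U f‖
        ≤ waveNorm γ r (γ - 1) (dualExponent γ r k) * ‖f‖ := by
      refine (ContinuousLinearMap.adjoint U).le_of_opNorm_le ?_ _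
      rw [LinearIsometryEquiv.norm_map]
      exact ContinuousLinearMap.opNorm_le_bound _ hwU.le fun h =>
        (norm_wave hγ0 (sub_pos.2 hγ) hd k h).le
    rw [hnorm, mul_assoc, mul_assoc]
    gcongr
  · obtain ⟨h, hh⟩ := exists_freq_norm_pos
    set f : L2k γ r k := ⟨U h, wave_mem_L2k hγ0 (sub_pos.2 hγ) hd k h⟩ with hf
    have hfn : ‖f‖ = waveNorm γ r (γ - 1) (dualExponent γ r k) * ‖h‖ :=
      norm_wave hγ0 (sub_pos.2 hγ) hd k h
    have h1 : waveNorm γ r (γ - 1) (dualExponent γ r k) * ‖f‖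
        ≤ ‖ContinuousLinearMap.adjoint U f‖ := by
      -- For f = U h, ‖f‖² = ⟨U*f, h⟩, and Cauchy-Schwarz bounds ‖U*f‖ from below.
      have h2 : ‖f‖ ^ 2 ≤ ‖ContinuousLinearMap.adjoint U f‖ * ‖h‖ := by
        refine le_trans (le_of_eq ?_) (norm_inner_le_norm (𝕜 := ℂ) _ _)
        rw [ContinuousLinearMap.adjoint_inner_left]
        change _ = ‖inner ℂ (U h) (U h)‖
        rw [inner_self_eq_norm_sq_to_K]
        simp [hf]
      refine le_of_mul_le_mul_right (le_trans (le_of_eq ?_) h2) hh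
      rw [sq, hfn]; ring
    have h3 := (subLeray hγ k hk hd).le_opNorm f
    have hf0 : 0 < ‖f‖ := by rw [hfn]; positivity
    refine le_of_mul_le_mul_right (le_trans ?_ h3) hf0
    rw [hnorm, mul_assoc, mul_assoc]
    gcongr

/-- Every integral converges here, so the defining condition determines T f almost everywhere for
every f. -/
theorem isSubLeray_eq (hγ : 1 < γ) (k : ℕ) (hk : 0 < 2 * (k : ℝ) + r + 1)
    (hd : 0 < 2 * dualExponent γ r k + r + 1) {T : L2k γ r k →L[ℂ] L2k γ r k}
    (hT : IsSubLeray γ r k T) : T = subLeray hγ k hk hd := by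
  ext1 f
  refine Subtype.ext (Lp.ext ?_)
  filter_upwards [hT f (converges_of_mem hγ k hk hd f), subLeray_ae_eq hγ k hk hd f] with z h1 h2
  rw [h1, h2]

end

/-! ### Test functions on boxes. -/

section

variable {γ r δ : ℝ} {S : Set ℝ}

theorem lintegral_halfPlane_box (hS : MeasurableSet S) (hS0 : S ⊆ Ioi 0) {G : ℝ → ENNReal}
    (hG : Measurable G) :
    ∫⁻ q, (Icc 0 δ ×ˢ S).indicator (fun q => G q.2) q ∂halfPlane
      = ENNReal.ofReal δ * ∫⁻ α in S, G α := by
  have hbox : MeasurableSet (Icc 0 δ ×ˢ S) := measurableSet_Icc.prod hS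
  rw [lintegral_indicator hbox, halfPlane, Measure.restrict_restrict hbox,
    inter_eq_left.2 (prod_mono (subset_univ _) hS0), Measure.volume_eq_prod,
    ← Measure.prod_restrict, lintegral_prod _ (by fun_prop)]
  simp [mul_comm]

theorem lintegral_weighted_box (hS : MeasurableSet S) (hS0 : S ⊆ Ioi 0) {G : ℝ → ENNReal}
    (hG : Measurable G) :
    ∫⁻ q, (Icc 0 δ ×ˢ S).indicator (fun q => G q.2) q ∂weighted r
      = ENNReal.ofReal δ * ∫⁻ α in S, ENNReal.ofReal (α ^ r) * G α := by
  have hbox : MeasurableSet (Icc 0 δ ×ˢ S) := measurableSet_Icc.prod hS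
  rw [← lintegral_halfPlane_box hS hS0 (by fun_prop), weighted,
    lintegral_withDensity_eq_lintegral_mul _ (measurable_weight r)
      (Measurable.indicator (by fun_prop) hbox)]
  refine lintegral_congr fun q => ?_
  by_cases hq : q ∈ Icc 0 δ ×ˢ S <;> simp [hq]

/-- The test function `1_{[0, δ]}(s) 1_S(α) α^e`. -/
def box (δ : ℝ) (S : Set ℝ) (e : ℝ) (q : ℝ × ℝ) : ℝ :=
  (Icc 0 δ ×ˢ S).indicator (fun q => q.2 ^ e) q

theorem measurable_box (hS : MeasurableSet S) (e : ℝ) : Measurable (box δ S e) :=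
  Measurable.indicator (by fun_prop) (measurableSet_Icc.prod hS)

theorem box_nonneg (hS0 : S ⊆ Ioi 0) (e : ℝ) (q : ℝ × ℝ) : 0 ≤ box δ S e q :=
  indicator_nonneg (fun _ hq => Real.rpow_nonneg (hS0 hq.2).le e) q

theorem integral_box (hδ : 0 < δ) (hS : MeasurableSet S) (hS0 : S ⊆ Ioi 0) {e : ℝ}
    (hI : ∫⁻ α in S, ENNReal.ofReal (α ^ e) ≠ ⊤) :
    Integrable (box δ S e) halfPlane ∧
      ∫ q, box δ S e q ∂halfPlane = δ * (∫⁻ α in S, ENNReal.ofReal (α ^ e)).toReal := by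
  have h : ∫⁻ q, ENNReal.ofReal (box δ S e q) ∂halfPlane
      = ENNReal.ofReal δ * ∫⁻ α in S, ENNReal.ofReal (α ^ e) := by
    rw [← lintegral_halfPlane_box hS hS0 (by fun_prop)]
    refine lintegral_congr fun q => ?_
    by_cases hq : q ∈ Icc 0 δ ×ˢ S <;> simp [box, hq]
  have hnn : 0 ≤ᵐ[halfPlane] box δ S e := Filter.Eventually.of_forall (box_nonneg hS0 e)
  constructor
  · refine (lintegral_ofReal_ne_top_iff_integrable
      (measurable_box hS e).aestronglyMeasurable hnn).1 ?_
    rw [h]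
    exact ENNReal.mul_ne_top ENNReal.ofReal_ne_top hI
  · rw [integral_eq_lintegral_of_nonneg_ae hnn (measurable_box hS e).aestronglyMeasurable, h,
      ENNReal.toReal_mul, ENNReal.toReal_ofReal hδ.le]

/-- The test function `1_{[0, δ]}(s) 1_S(α) α^e e^{ikθ}` on `M_γ`. -/
def boxFun (δ : ℝ) (S : Set ℝ) (e : ℝ) (k : ℕ) (ζ : ℂ × ℂ) : ℂ :=
  (box δ S e (ζ.2.re, ‖ζ.1‖) : ℂ) * (ζ.1 / (‖ζ.1‖ : ℂ)) ^ k

theorem measurable_boxFun (hS : MeasurableSet S) (e : ℝ) (k : ℕ) :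
    Measurable (boxFun δ S e k) := by
  have h : Measurable fun ζ : ℂ × ℂ => box δ S e (ζ.2.re, ‖ζ.1‖) :=
    (measurable_box hS e).comp (by fun_prop)
  exact (Complex.measurable_ofReal.comp h).mul (by fun_prop)

theorem lintegral_boxFun_sq (hS : MeasurableSet S) (hS0 : S ⊆ Ioi 0) (e : ℝ) (k : ℕ) :
    ∫⁻ ζ, ‖boxFun δ S e k ζ‖ₑ ^ 2 ∂mu γ r = ENNReal.ofReal (2 * Real.pi) *
      (ENNReal.ofReal δ * ∫⁻ α in S, ENNReal.ofReal (α ^ (2 * e + r))) := by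
  have e0 : ∫⁻ ζ, ‖boxFun δ S e k ζ‖ₑ ^ 2 ∂mu γ r
      = ∫⁻ ζ, ‖box δ S e (ζ.2.re, ‖ζ.1‖)‖ₑ ^ 2 ∂mu γ r := by
    refine lintegral_congr_ae ?_
    filter_upwards [ae_mu_norm_pos γ r] with ζ hζ
    rw [boxFun, enorm_mul, enorm_unit_pow hζ, mul_one]
    congr 1
    simp [enorm_eq_nnnorm]
  have e1 (q : ℝ × ℝ) : ‖box δ S e q‖ₑ ^ 2
      = (Icc 0 δ ×ˢ S).indicator (fun q => ENNReal.ofReal (q.2 ^ e) ^ 2) q := by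
    by_cases hq : q ∈ Icc 0 δ ×ˢ S
    · have : 0 < q.2 := hS0 hq.2
      simp only [box, indicator_of_mem hq]
      rw [Real.enorm_of_nonneg (by positivity)]
    · simp [box, hq]
  rw [e0, lintegral_mu_radial ((measurable_box hS e).enorm.pow_const 2)]
  simp_rw [e1]
  rw [lintegral_weighted_box hS hS0 (G := fun α => ENNReal.ofReal (α ^ e) ^ 2) (by fun_prop)]
  congr 2
  refine setLIntegral_congr_fun hS fun α hα => ?_
  have hα : 0 < α := hS0 hα
  rw [← ENNReal.ofReal_pow (by positivity), ← ENNReal.ofReal_mul (by positivity),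
    ← Real.rpow_mul_natCast hα.le, ← Real.rpow_add hα]
  congr 2
  push_cast; ring

theorem memLp_boxFun (hS : MeasurableSet S) (hS0 : S ⊆ Ioi 0) {e : ℝ} (k : ℕ)
    (hI : ∫⁻ α in S, ENNReal.ofReal (α ^ (2 * e + r)) ≠ ⊤) :
    MemLp (boxFun δ S e k) 2 (mu γ r) := by
  refine ⟨(measurable_boxFun hS e k).aestronglyMeasurable, ?_⟩
  have h := eLpNorm_nnreal_pow_eq_lintegral (f := boxFun δ S e k) (μ := mu γ r) (p := 2)
    two_ne_zero
  have e3 : eLpNorm (boxFun δ S e k) 2 (mu γ r) ^ 2 < ⊤ := by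
    have : eLpNorm (boxFun δ S e k) 2 (mu γ r) ^ 2
        = ∫⁻ ζ, ‖boxFun δ S e k ζ‖ₑ ^ 2 ∂mu γ r := by simpa using h
    rw [this, lintegral_boxFun_sq hS hS0]
    exact (ENNReal.mul_ne_top ENNReal.ofReal_ne_top
      (ENNReal.mul_ne_top ENNReal.ofReal_ne_top hI)).lt_top
  simpa using e3

/-- The reciprocal power of the phase has positive real part near a real point. -/
theorem exists_le_re_inv_phase_pow (hγ : 1 < γ) (k : ℕ) {α₀ β₀ : ℝ}
    (h0 : 0 < (γ - 1) * α₀ ^ γ + β₀ ^ γ) :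
    ∃ δ > 0, ∃ c > 0, ∀ q p : ℝ × ℝ, q.1 ∈ Icc 0 δ → q.2 ∈ Icc α₀ (α₀ + δ) → p.1 ∈ Icc 0 δ →
      p.2 ∈ Icc β₀ (β₀ + δ) → c ≤ (1 / phase γ q p ^ (k + 2)).re := by
  set x₀ : (ℝ × ℝ) × (ℝ × ℝ) := ((0, α₀), (0, β₀)) with hx₀
  set P : ℝ := (γ - 1) * α₀ ^ γ + β₀ ^ γ with hP
  have hval : phase γ x₀.1 x₀.2 = (P : ℂ) := by simp [phase, hx₀, hP]
  have hcr : Continuous fun x : ℝ => x ^ γ := Real.continuous_rpow_const (by linarith)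
  have hcp : Continuous fun x : (ℝ × ℝ) × (ℝ × ℝ) => phase γ x.1 x.2 := by
    unfold phase
    have h1 : Continuous fun x : (ℝ × ℝ) × (ℝ × ℝ) => x.1.2 ^ γ := hcr.comp (by fun_prop)
    have h2 : Continuous fun x : (ℝ × ℝ) × (ℝ × ℝ) => x.2.2 ^ γ := hcr.comp (by fun_prop)
    fun_prop
  have hne : phase γ x₀.1 x₀.2 ^ (k + 2) ≠ 0 := by
    rw [hval]; exact pow_ne_zero _ (by exact_mod_cast h0.ne')
  have hcont : ContinuousAt (fun x : (ℝ × ℝ) × (ℝ × ℝ) => (1 / phase γ x.1 x.2 ^ (k + 2)).re) x₀ :=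
    Complex.continuous_re.continuousAt.comp
      (continuousAt_const.div (hcp.pow _).continuousAt hne)
  have hpos : 0 < (1 / phase γ x₀.1 x₀.2 ^ (k + 2)).re := by
    rw [hval, ← Complex.ofReal_pow, ← Complex.ofReal_one, ← Complex.ofReal_div, Complex.ofReal_re]
    positivity
  obtain ⟨ε, hε, hball⟩ := Metric.eventually_nhds_iff.1
    (hcont.eventually (lt_mem_nhds (half_lt_self hpos)))
  refine ⟨ε / 2, by positivity, _, half_pos hpos, fun q p h1 h2 h3 h4 => ?_⟩
  refine (hball (y := (q, p)) ?_).le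
  have hd (a x : ℝ) (h : x ∈ Icc a (a + ε / 2)) : dist x a < ε := by
    rw [Real.dist_eq, abs_of_nonneg (by linarith [h.1])]
    linarith [h.2]
  rw [Prod.dist_eq, Prod.dist_eq, Prod.dist_eq]
  simp only [hx₀, max_lt_iff]
  exact ⟨⟨hd 0 _ (by simpa using h1), hd _ _ h2⟩, hd 0 _ (by simpa using h3), hd _ _ h4⟩

/-- The exponent d = `dualExponent` is chosen so that the kernel's power α^{d+r} times α^d is
α^{2d+r}, the density of the squared norm of the test function. -/
theorem reducedKernel_mul_box (k : ℕ) (hS0 : S ⊆ Ioi 0) (q p : ℝ × ℝ) :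
    reducedKernel γ k q p * (box δ S (dualExponent γ r k) q : ℂ)
      = ((reducedConst γ k * (k + 1).factorial * p.2 ^ k *
          box δ S (2 * dualExponent γ r k + r) q : ℝ) : ℂ) * (1 / phase γ q p ^ (k + 2)) := by
  by_cases hq : q ∈ Icc 0 δ ×ˢ S
  · have hpos : 0 < q.2 := hS0 hq.2
    simp only [box, indicator_of_mem hq, reducedKernel]
    have : q.2 ^ (2 * dualExponent γ r k + r)
        = q.2 ^ ((γ - 1) * (k + 1)) * q.2 ^ dualExponent γ r k := by
      rw [← Real.rpow_add hpos, dualExponent]; congr 1; ring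
    rw [this]
    push_cast
    ring
  · simp [box, hq]

theorem integrable_reducedKernel_mul_box (hγ : 1 < γ) (k : ℕ) (hδ : 0 < δ)
    (hS : MeasurableSet S) (hS0 : S ⊆ Ioi 0)
    (hI : ∫⁻ α in S, ENNReal.ofReal (α ^ (2 * dualExponent γ r k + r)) ≠ ⊤) {p : ℝ × ℝ}
    (hp : 0 < p.2) :
    Integrable (fun q => reducedKernel γ k q p * (box δ S (dualExponent γ r k) q : ℂ))
      halfPlane := by
  simp_rw [reducedKernel_mul_box k hS0]
  have h1 := ((integral_box hδ hS hS0 hI).1.const_mul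
    (reducedConst γ k * (k + 1).factorial * p.2 ^ k)).ofReal (𝕜 := ℂ)
  have hm : Measurable fun q => 1 / phase γ q p ^ (k + 2) := by
    unfold phase; fun_prop
  refine h1.mul_bdd (c := 1 / (p.2 ^ γ) ^ (k + 2)) hm.aestronglyMeasurable ?_
  filter_upwards [ae_halfPlane_pos] with q hq
  rw [norm_div, norm_one, norm_pow]
  have : p.2 ^ γ ≤ ‖phase γ q p‖ := by
    refine le_trans ?_ (Complex.re_le_norm _)
    rw [phase_re]
    have : 0 ≤ (γ - 1) * q.2 ^ γ := mul_nonneg (by linarith) (by positivity)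
    linarith
  have hp' : 0 < p.2 ^ γ := by positivity
  gcongr

end

/-! ### Necessity of the interval. -/

section

variable {γ r δ : ℝ} {S : Set ℝ}

/-- The phase factor has real part at least c on the box and everything else is nonnegative, so the
real part of the integral cannot cancel. -/
theorem le_norm_transform_box (hγ : 1 < γ) (k : ℕ) (hδ : 0 < δ) {c : ℝ}
    (hS : MeasurableSet S) (hS0 : S ⊆ Ioi 0)
    (hI : ∫⁻ α in S, ENNReal.ofReal (α ^ (2 * dualExponent γ r k + r)) ≠ ⊤)
    {f : ℂ × ℂ → ℂ} (hf : f =ᵐ[mu γ r] boxFun δ S (dualExponent γ r k) k) {z : ℂ × ℂ}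
    (hz : z ∈ hypersurface γ) (hz0 : 0 < ‖z.1‖)
    (hc : ∀ q : ℝ × ℝ, q.1 ∈ Icc 0 δ → q.2 ∈ S →
      c ≤ (1 / phase γ q (z.2.re, ‖z.1‖) ^ (k + 2)).re) :
    reducedConst γ k * (k + 1).factorial * c * δ *
        (∫⁻ α in S, ENNReal.ofReal (α ^ (2 * dualExponent γ r k + r))).toReal * ‖z.1‖ ^ k
      ≤ ‖transform γ f z‖ := by
  have hK := reducedConst_pos (zero_lt_one.trans hγ) k
  set p : ℝ × ℝ := (z.2.re, ‖z.1‖) with hp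
  have hint := integrable_reducedKernel_mul_box (r := r) hγ k hδ hS hS0 hI (p := p) hz0
  obtain ⟨hb1, hb2⟩ := integral_box hδ hS hS0 hI
  rw [transform_eq hγ k hz hz0 (g := fun q => (box δ S (dualExponent γ r k) q : ℂ)) hf, norm_mul,
    norm_unit_pow hz0, one_mul]
  refine le_trans ?_ (Complex.re_le_norm _)
  rw [← Complex.reCLM_apply, ← Complex.reCLM.integral_comp_comm hint]
  calc _ = ∫ q, (reducedConst γ k * (k + 1).factorial * p.2 ^ k) * c *
        box δ S (2 * dualExponent γ r k + r) q ∂halfPlane := by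
        rw [integral_const_mul, hb2]; ring
    _ ≤ _ := by
        refine integral_mono (hb1.const_mul _) (Complex.reCLM.integrable_comp hint) fun q => ?_
        simp only [Complex.reCLM_apply]
        rw [reducedKernel_mul_box k hS0, Complex.re_ofReal_mul]
        by_cases hq : q ∈ Icc 0 δ ×ˢ S
        · have h1 := hc q hq.1 hq.2
          have h2 := box_nonneg (δ := δ) hS0 (2 * dualExponent γ r k + r) q
          have h3 : 0 ≤ reducedConst γ k * (k + 1).factorial * p.2 ^ k *
            box δ S (2 * dualExponent γ r k + r) q := by positivity
          calc _ = reducedConst γ k * (k + 1).factorial * p.2 ^ k *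
                  box δ S (2 * dualExponent γ r k + r) q * c := by ring
            _ ≤ _ := mul_le_mul_of_nonneg_left h1 h3
        · simp [box, hq]

/-- A bound for `L_k` on functions supported in a box, seen from another box. -/
theorem lintegral_mul_lintegral_le (hγ : 1 < γ) (k : ℕ) (hδ : 0 < δ) {c : ℝ} (hc0 : 0 < c)
    {T : L2k γ r k →L[ℂ] L2k γ r k} (hT : IsSubLeray γ r k T)
    (hS : MeasurableSet S) (hS0 : S ⊆ Ioi 0) {B : Set ℝ} (hB : MeasurableSet B) (hB0 : B ⊆ Ioi 0)
    (hI : ∫⁻ α in S, ENNReal.ofReal (α ^ (2 * dualExponent γ r k + r)) ≠ ⊤)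
    (hc : ∀ q p : ℝ × ℝ, q.1 ∈ Icc 0 δ → q.2 ∈ S → p.1 ∈ Icc 0 δ → p.2 ∈ B →
      c ≤ (1 / phase γ q p ^ (k + 2)).re) :
    ENNReal.ofReal (reducedConst γ k * (k + 1).factorial * c * δ) ^ 2 *
      ((∫⁻ α in S, ENNReal.ofReal (α ^ (2 * dualExponent γ r k + r))) *
        ∫⁻ β in B, ENNReal.ofReal (β ^ (2 * (k : ℝ) + r))) ≤ ‖T‖ₑ ^ 2 := by
  have hK := reducedConst_pos (zero_lt_one.trans hγ) k
  set I := ∫⁻ α in S, ENNReal.ofReal (α ^ (2 * dualExponent γ r k + r)) with hIdef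
  set J := ∫⁻ β in B, ENNReal.ofReal (β ^ (2 * (k : ℝ) + r)) with hJdef
  set a := reducedConst γ k * (k + 1).factorial * c * δ with ha
  have ha0 : 0 < a := by positivity
  have hmem := memLp_boxFun (γ := γ) (δ := δ) hS hS0 k hI
  have hfae := hmem.coeFn_toLp
  let f : L2k γ r k := ⟨hmem.toLp, fun q => (box δ S (dualExponent γ r k) q : ℂ),
    Complex.measurable_ofReal.comp (measurable_box hS _), hfae⟩
  -- T is tied to the Leray integral only where that integral converges, so convergence must be
  -- checked for the test function.
  have hconv : Converges γ r (f : L2 γ r) := by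
    filter_upwards [ae_mem_hypersurface γ r, ae_mu_norm_pos γ r] with z hz hz0
    have h := (integrable_reducedKernel_mul_box (r := r) hγ k hδ hS hS0 hI (p := (z.2.re, ‖z.1‖))
      hz0).const_mul ((z.1 / (‖z.1‖ : ℂ)) ^ k)
    refine h.congr ?_
    filter_upwards [circleIntegrand_eq hγ k hz hz0
      (g := fun q => (box δ S (dualExponent γ r k) q : ℂ)) hfae] with q hq
    exact (hq.trans (mul_assoc _ _ _)).symm
  have hfn : ‖f‖ₑ ^ 2 = ENNReal.ofReal (2 * Real.pi) * (ENNReal.ofReal δ * I) := by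
    rw [hIdef, ← lintegral_boxFun_sq hS hS0 (dualExponent γ r k) k]
    refine (enorm_sq_eq_lintegral (f : L2 γ r)).trans (lintegral_congr_ae ?_)
    filter_upwards [hfae] with z hz
    rw [show (f : L2 γ r) z = _ from hz]
  have hTn : ENNReal.ofReal (2 * Real.pi) * (ENNReal.ofReal δ *
      (ENNReal.ofReal a ^ 2 * I ^ 2 * J)) ≤ ‖T f‖ₑ ^ 2 := by
    set H : ℝ → ENNReal := fun β => ENNReal.ofReal (a * I.toReal * β ^ k) ^ 2 with hH
    have hHm : Measurable H := by fun_prop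
    have e1 : ∫⁻ z : ℂ × ℂ, (Icc 0 δ ×ˢ B).indicator (fun q : ℝ × ℝ => H q.2) (z.2.re, ‖z.1‖)
        ∂mu γ r = ENNReal.ofReal (2 * Real.pi) * (ENNReal.ofReal δ *
      (ENNReal.ofReal a ^ 2 * I ^ 2 * J)) := by
      rw [lintegral_mu_radial (Measurable.indicator (by fun_prop) (measurableSet_Icc.prod hB)),
        lintegral_weighted_box hB hB0 hHm]
      congr 2
      rw [hJdef, ← lintegral_const_mul _ (by fun_prop)]
      refine setLIntegral_congr_fun hB fun β hβ => ?_
      have hβ : 0 < β := hB0 hβ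
      simp only [hH]
      rw [ENNReal.ofReal_mul (by positivity), ENNReal.ofReal_mul ha0.le, ENNReal.ofReal_toReal hI,
        mul_pow, mul_pow, mul_left_comm]
      congr 1
      rw [← ENNReal.ofReal_pow (by positivity), ← ENNReal.ofReal_mul (by positivity)]
      congr 1
      rw [Real.rpow_add hβ, mul_comm, mul_comm 2 (k : ℝ), Real.rpow_mul hβ.le]
      norm_cast
    rw [← e1]
    refine le_trans (lintegral_mono_ae ?_) (enorm_sq_eq_lintegral (T f : L2 γ r)).ge
    filter_upwards [ae_mem_hypersurface γ r, ae_mu_norm_pos γ r, hT f hconv] with z hz hz0 hTz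
    by_cases hq : (z.2.re, ‖z.1‖) ∈ Icc 0 δ ×ˢ B
    · rw [indicator_of_mem hq, hTz]
      simp only [hH]
      rw [← ofReal_norm]
      gcongr
      exact le_norm_transform_box hγ k hδ hS hS0 hI hfae hz hz0
        fun q h1 h2 => hc q _ h1 h2 hq.1 hq.2
    · rw [indicator_of_notMem hq]
      exact zero_le
  have hop : ‖T f‖ₑ ^ 2 ≤ ‖T‖ₑ ^ 2 * ‖f‖ₑ ^ 2 := by
    rw [← mul_pow]
    gcongr
    exact T.le_opENorm f
  rw [hfn] at hop
  by_cases hI0 : I = 0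
  · simp [hI0]
  have hD0 : ENNReal.ofReal (2 * Real.pi) * (ENNReal.ofReal δ * I) ≠ 0 := by
    simp [hI0, hδ, Real.pi_pos]
  have hDt : ENNReal.ofReal (2 * Real.pi) * (ENNReal.ofReal δ * I) ≠ ⊤ :=
    ENNReal.mul_ne_top ENNReal.ofReal_ne_top (ENNReal.mul_ne_top ENNReal.ofReal_ne_top hI)
  -- ‖T f‖² is at least of order I²J while ‖f‖² is of order I; dividing leaves I · J.
  refine (ENNReal.mul_le_mul_iff_left hD0 hDt).1 (le_trans (le_of_eq ?_) (hTn.trans hop))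
  ring

/-- Boundedness of `L_k` forces the local integrability of the squared profiles. -/
theorem lintegral_mul_lintegral_lt_top (hγ : 1 < γ) (k : ℕ) {T : L2k γ r k →L[ℂ] L2k γ r k}
    (hT : IsSubLeray γ r k T) {α₀ β₀ : ℝ} (hα₀ : 0 ≤ α₀) (hβ₀ : 0 ≤ β₀)
    (h0 : 0 < (γ - 1) * α₀ ^ γ + β₀ ^ γ) :
    ∃ δ > 0, (∫⁻ α in Ioo α₀ (α₀ + δ), ENNReal.ofReal (α ^ (2 * dualExponent γ r k + r))) *
      ∫⁻ β in Ioo β₀ (β₀ + δ), ENNReal.ofReal (β ^ (2 * (k : ℝ) + r)) < ⊤ := by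
  obtain ⟨δ, hδ, c, hc0, hc⟩ := exists_le_re_inv_phase_pow hγ k h0
  refine ⟨δ, hδ, ?_⟩
  have hK := reducedConst_pos (zero_lt_one.trans hγ) k
  set e := 2 * dualExponent γ r k + r with he
  set J := ∫⁻ β in Ioo β₀ (β₀ + δ), ENNReal.ofReal (β ^ (2 * (k : ℝ) + r)) with hJ
  set a := reducedConst γ k * (k + 1).factorial * c * δ with ha
  have ha0 : 0 < a := by positivity
  -- Staying away from α₀ keeps the test function in L² even if α^{2d+r} is not integrable at 0. The
  -- bound is uniform in n, so monotone convergence removes the truncation.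
  set S : ℕ → Set ℝ := fun n => Ioo (α₀ + 1 / ((n : ℝ) + 1)) (α₀ + δ) with hSdef
  have hSsub (n : ℕ) : S n ⊆ Ioo α₀ (α₀ + δ) :=
    Ioo_subset_Ioo_left (by have := Nat.one_div_pos_of_nat (α := ℝ) (n := n); linarith)
  have hmono : Monotone S := fun m n hmn =>
    Ioo_subset_Ioo_left (by have := Nat.one_div_le_one_div (α := ℝ) hmn; linarith)
  have hU : ⋃ n, S n = Ioo α₀ (α₀ + δ) := by
    refine subset_antisymm (iUnion_subset hSsub) fun x hx => ?_
    obtain ⟨n, hn⟩ := exists_nat_one_div_lt (sub_pos.2 hx.1)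
    exact mem_iUnion.2 ⟨n, by linarith, hx.2⟩
  have hbound (n : ℕ) : (∫⁻ α in S n, ENNReal.ofReal (α ^ e)) * J
      ≤ (ENNReal.ofReal a ^ 2)⁻¹ * ‖T‖ₑ ^ 2 := by
    have hn := Nat.one_div_pos_of_nat (α := ℝ) (n := n)
    have hI : ∫⁻ α in S n, ENNReal.ofReal (α ^ e) ≠ ⊤ := by
      have hcont : ContinuousOn (fun x : ℝ => x ^ e) (Icc (α₀ + 1 / ((n : ℝ) + 1)) (α₀ + δ)) :=
        fun x hx => (Real.continuousAt_rpow_const x e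
          (Or.inl (by linarith [hx.1] : 0 < x).ne')).continuousWithinAt
      exact ((hcont.integrableOn_Icc).mono_set Ioo_subset_Icc_self).lintegral_lt_top.ne
    have h := lintegral_mul_lintegral_le hγ k hδ hc0 hT measurableSet_Ioo
      ((hSsub n).trans fun x hx => hα₀.trans_lt hx.1) measurableSet_Ioo
      (fun x (hx : x ∈ Ioo β₀ (β₀ + δ)) => hβ₀.trans_lt hx.1) hI
      fun q p h1 h2 h3 h4 => hc q p h1 (Ioo_subset_Icc_self (hSsub n h2)) h3
        (Ioo_subset_Icc_self h4)
    have hne : ENNReal.ofReal a ^ 2 ≠ 0 := by simp [ha0]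
    have hnt : ENNReal.ofReal a ^ 2 ≠ ⊤ := ENNReal.pow_ne_top ENNReal.ofReal_ne_top
    calc _ = (ENNReal.ofReal a ^ 2)⁻¹ * (ENNReal.ofReal a ^ 2 *
          ((∫⁻ α in S n, ENNReal.ofReal (α ^ e)) * J)) := by
          rw [← mul_assoc, ENNReal.inv_mul_cancel hne hnt, one_mul]
      _ ≤ _ := by gcongr
  have hlim : (∫⁻ α in Ioo α₀ (α₀ + δ), ENNReal.ofReal (α ^ e)) * J
      ≤ (ENNReal.ofReal a ^ 2)⁻¹ * ‖T‖ₑ ^ 2 := by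
    rw [← hU, setLIntegral_iUnion_of_directed _ hmono.directed_le, ENNReal.iSup_mul]
    exact iSup_le hbound
  refine hlim.trans_lt (ENNReal.mul_lt_top ?_ (ENNReal.pow_lt_top enorm_lt_top))
  rw [ENNReal.inv_lt_top]
  exact ENNReal.pow_pos (ENNReal.ofReal_pos.2 ha0) 2

theorem setLIntegral_rpow_ne_zero {a δ : ℝ} (ha : 0 ≤ a) (hδ : 0 < δ) (e : ℝ) :
    ∫⁻ x in Ioo a (a + δ), ENNReal.ofReal (x ^ e) ≠ 0 := by
  refine ((setLIntegral_pos_iff (by fun_prop)).2 ?_).ne'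
  rw [inter_eq_right.2]
  · simpa using hδ
  · intro x hx
    have : 0 < x := ha.trans_lt hx.1
    simpa using Real.rpow_pos_of_pos this e

theorem neg_one_lt_of_setLIntegral_rpow_ne_top {δ e : ℝ} (hδ : 0 < δ)
    (h : ∫⁻ x in Ioo 0 (0 + δ), ENNReal.ofReal (x ^ e) ≠ ⊤) : -1 < e := by
  rw [zero_add] at h
  rw [← intervalIntegral.integrableOn_Ioo_rpow_iff hδ]
  refine (lintegral_ofReal_ne_top_iff_integrable
    (by fun_prop : Measurable fun x : ℝ => x ^ e).aestronglyMeasurable ?_).1 h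
  filter_upwards [ae_restrict_mem measurableSet_Ioo] with x hx
  exact Real.rpow_nonneg hx.1.le e

theorem mem_interval_iff {k : ℕ} :
    r ∈ interval γ k ↔ 0 < 2 * (k : ℝ) + r + 1 ∧ 0 < 2 * dualExponent γ r k + r + 1 := by
  rw [interval, mem_Ioo, dualExponent]
  constructor <;> rintro ⟨h1, h2⟩ <;> constructor <;> linarith

/-- At the base points (α₀, β₀) = (1, 0) and (0, 1) the phase is γ - 1 and 1, both positive. The
factor based at 1 is nonzero, so the factor based at 0 must be finite, which gives one endpoint
each. -/
theorem mem_interval_of_isSubLeray (hγ : 1 < γ) {k : ℕ} {T : L2k γ r k →L[ℂ] L2k γ r k}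
    (hT : IsSubLeray γ r k T) : r ∈ interval γ k := by
  have hγ0 : γ ≠ 0 := by linarith
  rw [mem_interval_iff]
  constructor
  · obtain ⟨δ, hδ, h⟩ := lintegral_mul_lintegral_lt_top hγ k hT zero_le_one le_rfl
      (by rw [Real.one_rpow, Real.zero_rpow hγ0]; linarith)
    have := neg_one_lt_of_setLIntegral_rpow_ne_top hδ fun hJ => by
      rw [hJ, ENNReal.mul_top (setLIntegral_rpow_ne_zero zero_le_one hδ _)] at h
      exact h.ne rfl
    linarith
  · obtain ⟨δ, hδ, h⟩ := lintegral_mul_lintegral_lt_top hγ k hT le_rfl zero_le_one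
      (by rw [Real.one_rpow, Real.zero_rpow hγ0]; linarith)
    have := neg_one_lt_of_setLIntegral_rpow_ne_top hδ fun hI => by
      rw [hI, ENNReal.top_mul (setLIntegral_rpow_ne_zero zero_le_one hδ _)] at h
      exact h.ne rfl
    linarith

end

end Leray

end

theorem theorem1p3 (γ : ℝ) (hγ : 1 < γ) (k : ℕ) (r : ℝ) :
    ((∃ T : Leray.L2k γ r k →L[ℂ] Leray.L2k γ r k, Leray.IsSubLeray γ r k T) ↔
      r ∈ Leray.interval γ k) ∧
    (r ∈ Leray.interval γ k →
      (∀ f : Leray.L2k γ r k, Leray.Converges γ r (f : Leray.L2 γ r)) ∧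
      ∀ T : Leray.L2k γ r k →L[ℂ] Leray.L2k γ r k, Leray.IsSubLeray γ r k T →
        ‖T‖ = √(Leray.symbol γ r k)) := by
  refine ⟨⟨fun ⟨T, hT⟩ => Leray.mem_interval_of_isSubLeray hγ hT, fun hr => ?_⟩, fun hr => ?_⟩
  · obtain ⟨hk, hd⟩ := Leray.mem_interval_iff.1 hr
    exact ⟨Leray.subLeray hγ k hk hd, fun f _ => Leray.subLeray_ae_eq hγ k hk hd f⟩
  · obtain ⟨hk, hd⟩ := Leray.mem_interval_iff.1 hr
    refine ⟨Leray.converges_of_mem hγ k hk hd, fun T hT => ?_⟩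
    rw [Leray.isSubLeray_eq hγ k hk hd hT, Leray.norm_subLeray]
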